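/- For a finite simple graph $G$ and an integer $t\ge 0$, let $\mathrm{int}(G,t)$ be the number of $t$-element sets of edges of $G$ in which any two edges share a vertex. Order the two-element subsets of $[n]=\{1,\dots,n\}$ lexicographically: $A$ precedes $B$ if $\min(A\,\triangle\,B)\in A$. For $0\le m\le\binom n2$ let $\mathcal L_{n,2}(m)$ be the graph on $[n]$ whose edges are the first $m$ two-element subsets of $[n]$ in this order. Let $t,n,\ell\ge 0$ be integers. If $t\ne 1$, suppose that $n\ge 2^{2+6/(t-1)}\,\ell$ (for $t=1$ no condition is imposed). Then for every integer $m$ with $0\le m\le\binom n2-\binom{n-\ell}2$, the graph $\mathcal L_{n,2}(m)$ maximises $\mathrm{int}(G,t)$ over all graphs $G$ on $[n]$ with $m$ edges; that is, $\mathcal L_{n,2}(m)$ has $m$ edges and $\mathrm{int}(G,t)\le\mathrm{int}(\mathcal L_{n,2}(m),t)$ for every graph $G$ on $[n]$ with $m$ edges. (Here $\binom{n-\ell}{2}$ is read as $0$ when $\ell>n$.) -/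

import Mathlib

/-- The lexicographic order on finite sets: `A` precedes `B` when `min (A ∆ B)` exists and
belongs to `A`. The element of `[n]` numbered `i` is represented by `i - 1 : Fin n`. -/
def LexBefore {n : ℕ} (A B : Finset (Fin n)) : Prop :=
  ∃ x ∈ symmDiff A B, (∀ y ∈ symmDiff A B, x ≤ y) ∧ x ∈ A

/-- The first `m` sets, in lexicographic order, among the `k`-element subsets of `[n]`:
those preceded by fewer than `m` others. -/
noncomputable def lexFamily (n k m : ℕ) : Finset (Finset (Fin n)) :=
  open Classical in
  {A ∈ Finset.powersetCard k (Finset.univ : Finset (Fin n)) |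
    ((Finset.powersetCard k (Finset.univ : Finset (Fin n))).filter
      (fun B => LexBefore B A)).card < m}

/-- The lexicographic graph: its edges are the first `m` two-element subsets of `[n]`. -/
def lexGraph (n m : ℕ) : SimpleGraph (Fin n) where
  Adj i j := i ≠ j ∧ {i, j} ∈ lexFamily n 2 m
  symm := ⟨fun i j h => ⟨h.1.symm, by rw [Finset.pair_comm]; exact h.2⟩⟩
  loopless := ⟨fun _ h => h.1 rfl⟩

/-- A set of edges is intersecting when any two of its members share a vertex. -/
def IntersectingEdges {n : ℕ} (H : Finset (Sym2 (Fin n))) : Prop :=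
  ∀ e ∈ H, ∀ f ∈ H, ∃ v, v ∈ e ∧ v ∈ f

/-- The number of edges of a graph on `[n]`. -/
noncomputable def numEdges {n : ℕ} (G : SimpleGraph (Fin n)) : ℕ :=
  open Classical in G.edgeFinset.card

/-- The number of intersecting subgraphs of `G` with exactly `t` edges, a subgraph being
identified with its set of edges. -/
noncomputable def interCount {n : ℕ} (G : SimpleGraph (Fin n)) (t : ℕ) : ℕ :=
  open Classical in
  ((G.edgeFinset.powersetCard t).filter (fun H => IntersectingEdges H)).card

/-! For `t ≥ 2` an intersecting set of `t` edges is a star with a unique centre or, if `t = 3`,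
possibly a triangle. So `interCount` is `∑ C(d(v), t)`, plus the number of triangles when `t = 3`
(`interCount_eq_wt`). This is a weight `∑ f(d(v)) + θ · #triangles` with `f` monotone, convex and of
third differences at least `θ ≥ 0`, a condition that lets the degree term pay for triangles.
Deleting a vertex adjacent to all others replaces `f` by `x ↦ f (x + 1)`, which stays in the class,
so the problem is suited to induction.

Let the lexicographic graph have `a` vertices joined to everything and one further vertex with `s`
more edges. Take a maximiser of the weight, ties broken by `∑ d(v)²`. Compression shows that its
neighbourhoods are nested (`IsOpt.nested`), so every non-neighbour of a vertex `v` of maximum degree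
is isolated. `wt_le_lexWt` is an induction on `a` that starts from the star bound `wt_le_star`. If
some vertex is full, it is deleted and `a` drops. Otherwise the maximum degree decides.

If it is small, a linear bound `f(d) - f(0) ≤ ρ d`, with room for triangles, keeps the weight below
what the `a` full vertices of the lexicographic graph already guarantee (`wt_le_lexWt_of_rate`). The
main use of `n ≥ 2^(2+6/(t-1)) ℓ` is here, through `exists_rate_of_pow`.

If it is large, an edge whose ends both have degree below a threshold `K` could profitably be moved
to a missing pair at `v` (`IsOpt.not_small_edge`), so every edge has an end of degree at least `K`.
Isolated and full vertices are then peeled off one by one (`wt_le_lexWt_of_cover`). Peeling an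
isolated vertex needs the lexicographic weight not to decrease when a vertex is added
(`exists_lexWt_step`), which is proved when `a` is below about half the number of vertices. That
holds because there are at most about `3K²/8` edges on more than `K` vertices. With up to about `ℓN`
edges this dictates `K ≈ √(8ℓN/3)`. -/

open Finset

/-! ### Degree and triangle weights of induced subgraphs -/

section Weights

variable {V : Type*}

/-- The adjacency indicator of a graph, with real values. -/
noncomputable def adjInd (G : SimpleGraph V) (x y : V) : ℝ :=
  open Classical in if G.Adj x y then 1 else 0

/-- The degree of `x` in the subgraph induced on `S`. -/
noncomputable def dg (G : SimpleGraph V) (S : Finset V) (x : V) : ℕ :=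
  open Classical in (S.filter (fun y => G.Adj x y)).card

/-- The sum of the degrees in the subgraph induced on `S`. -/
noncomputable def degSum (G : SimpleGraph V) (S : Finset V) : ℕ := ∑ x ∈ S, dg G S x

/-- The sum of the squared degrees in the subgraph induced on `S`. -/
noncomputable def degSq (G : SimpleGraph V) (S : Finset V) : ℕ := ∑ x ∈ S, dg G S x ^ 2

/-- The number of ordered closed triples of a symmetric weight on `S`. -/
noncomputable def triW (A : V → V → ℝ) (S : Finset V) : ℝ :=
  ∑ x ∈ S, ∑ y ∈ S, ∑ z ∈ S, A x y * A y z * A z x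

/-- The weight of the induced subgraph: a function of the degrees plus `θ` times the number of
triangles. -/
noncomputable def wt (f : ℕ → ℝ) (θ : ℝ) (G : SimpleGraph V) (S : Finset V) : ℝ :=
  ∑ x ∈ S, f (dg G S x) + θ * triW (adjInd G) S / 6

lemma adjInd_of_adj {G : SimpleGraph V} {x y : V} (h : G.Adj x y) : adjInd G x y = 1 := by
  simp [adjInd, h]

lemma adjInd_of_not_adj {G : SimpleGraph V} {x y : V} (h : ¬ G.Adj x y) : adjInd G x y = 0 := by
  simp [adjInd, h]

lemma adjInd_congr {G H : SimpleGraph V} {x y z w : V} (h : G.Adj x y ↔ H.Adj z w) :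
    adjInd G x y = adjInd H z w := by
  by_cases h' : G.Adj x y
  · rw [adjInd_of_adj h', adjInd_of_adj (h.1 h')]
  · rw [adjInd_of_not_adj h', adjInd_of_not_adj fun h'' => h' (h.2 h'')]

lemma adjInd_self (G : SimpleGraph V) (x : V) : adjInd G x x = 0 := by
  simp [adjInd]

lemma adjInd_comm (G : SimpleGraph V) (x y : V) : adjInd G x y = adjInd G y x := by
  by_cases h : G.Adj x y
  · rw [adjInd_of_adj h, adjInd_of_adj h.symm]
  · rw [adjInd_of_not_adj h, adjInd_of_not_adj fun h' => h h'.symm]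

lemma adjInd_nonneg (G : SimpleGraph V) (x y : V) : 0 ≤ adjInd G x y := by
  unfold adjInd; split_ifs <;> norm_num

lemma adjInd_le_one (G : SimpleGraph V) (x y : V) : adjInd G x y ≤ 1 := by
  unfold adjInd; split_ifs <;> norm_num

lemma dg_cast (G : SimpleGraph V) (S : Finset V) (x : V) :
    (dg G S x : ℝ) = ∑ y ∈ S, adjInd G x y := by
  simp only [dg, adjInd, Finset.sum_boole]

lemma degSum_cast (G : SimpleGraph V) (S : Finset V) :
    (degSum G S : ℝ) = ∑ x ∈ S, (dg G S x : ℝ) := by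
  simp [degSum]

variable [DecidableEq V]

lemma dg_cast_erase (G : SimpleGraph V) {S : Finset V} {v : V} (hv : v ∈ S) (x : V) :
    (dg G S x : ℝ) = dg G (S.erase v) x + adjInd G x v := by
  rw [dg_cast, dg_cast, Finset.sum_erase_add _ _ hv]

lemma dg_erase_of_adj {G : SimpleGraph V} {S : Finset V} {v x : V} (hv : v ∈ S)
    (h : G.Adj x v) : dg G S x = dg G (S.erase v) x + 1 := by
  have := dg_cast_erase G hv x
  rw [adjInd_of_adj h] at this
  exact_mod_cast this

lemma dg_erase_of_not_adj {G : SimpleGraph V} {S : Finset V} {v x : V} (hv : v ∈ S)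
    (h : ¬ G.Adj x v) : dg G S x = dg G (S.erase v) x := by
  have := dg_cast_erase G hv x
  rw [adjInd_of_not_adj h] at this
  exact_mod_cast (by simpa using this)

lemma dg_erase_self {G : SimpleGraph V} {S : Finset V} {v : V} (hv : v ∈ S) :
    dg G S v = dg G (S.erase v) v :=
  dg_erase_of_not_adj hv (G.loopless.irrefl v)

lemma degSum_erase (G : SimpleGraph V) {S : Finset V} {v : V} (hv : v ∈ S) :
    degSum G S = degSum G (S.erase v) + 2 * dg G S v := by
  have h : (degSum G S : ℝ) = degSum G (S.erase v) + 2 * dg G S v := by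
    rw [degSum_cast, degSum_cast, ← Finset.sum_erase_add _ _ hv]
    rw [Finset.sum_congr rfl (fun x _ => dg_cast_erase G hv x), Finset.sum_add_distrib]
    have : ∑ x ∈ S.erase v, adjInd G x v = dg G S v := by
      rw [dg_erase_self hv, dg_cast]
      exact Finset.sum_congr rfl (fun x _ => adjInd_comm G x v)
    rw [this]; ring
  exact_mod_cast h

lemma dg_lt_card (G : SimpleGraph V) {S : Finset V} {v : V} (hv : v ∈ S) :
    dg G S v + 1 ≤ S.card := by
  classical
  rw [dg_erase_self hv, ← Finset.card_erase_add_one hv]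
  exact Nat.succ_le_succ (Finset.card_filter_le _ _)

lemma adj_of_dg_full {G : SimpleGraph V} {S : Finset V} {v : V} (hv : v ∈ S)
    (h : dg G S v + 1 = S.card) {x : V} (hx : x ∈ S) (hxv : x ≠ v) : G.Adj v x := by
  classical
  by_contra hn
  have h1 := dg_erase_of_not_adj hx hn
  have h2 := dg_lt_card G (S := S.erase x) (v := v) (Finset.mem_erase.2 ⟨hxv.symm, hv⟩)
  have h3 := Finset.card_erase_add_one hx
  omega

lemma not_adj_of_dg_zero {G : SimpleGraph V} {S : Finset V} {v : V}
    (h : dg G S v = 0) {x : V} (hx : x ∈ S) : ¬ G.Adj v x := by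
  intro hn
  have h1 := dg_erase_of_adj hx hn
  omega

lemma triW_insert {A : V → V → ℝ} (h0 : ∀ x, A x x = 0) (hs : ∀ x y, A x y = A y x)
    {S : Finset V} {v : V} (hv : v ∉ S) :
    triW A (insert v S) = triW A S + 3 * ∑ y ∈ S, ∑ z ∈ S, A v y * A y z * A z v := by
  have e1 : ∑ x ∈ S, ∑ z ∈ S, A x v * A v z * A z x
      = ∑ y ∈ S, ∑ z ∈ S, A v y * A y z * A z v := by
    refine Finset.sum_congr rfl fun x _ => Finset.sum_congr rfl fun z _ => ?_
    rw [hs x v, hs v z, hs z x]; ring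
  have e2 : ∑ x ∈ S, ∑ y ∈ S, A x y * A y v * A v x
      = ∑ y ∈ S, ∑ z ∈ S, A v y * A y z * A z v := by
    refine Finset.sum_congr rfl fun x _ => Finset.sum_congr rfl fun z _ => ?_
    ring
  simp only [triW, Finset.sum_insert hv, h0, Finset.sum_add_distrib, zero_mul, mul_zero,
    Finset.sum_const_zero, zero_add]
  rw [e1, e2]; ring

lemma triW_erase {A : V → V → ℝ} (h0 : ∀ x, A x x = 0) (hs : ∀ x y, A x y = A y x)
    {S : Finset V} {v : V} (hv : v ∈ S) :
    triW A S = triW A (S.erase v) +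
      3 * ∑ y ∈ S.erase v, ∑ z ∈ S.erase v, A v y * A y z * A z v := by
  conv_lhs => rw [← Finset.insert_erase hv]
  exact triW_insert h0 hs (Finset.notMem_erase v S)

/-- Triples are split by whether they contain neither, exactly one, or both of `i` and `j`. -/
lemma triW_pair {A : V → V → ℝ} (h0 : ∀ x, A x x = 0) (hs : ∀ x y, A x y = A y x)
    {R : Finset V} {i j : V} (hij : i ≠ j) (hi : i ∉ R) (hj : j ∉ R) :
    triW A (insert i (insert j R)) = triW A R
      + 3 * ∑ y ∈ R, ∑ z ∈ R, (A i y * A i z + A j y * A j z) * A y z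
      + 6 * (A i j * ∑ z ∈ R, A i z * A j z) := by
  have hi' : i ∉ insert j R := by simp [hij, hi]
  rw [triW_insert h0 hs hi', triW_insert h0 hs hj]
  simp only [Finset.sum_insert hj, h0, Finset.sum_add_distrib, zero_mul, mul_zero, zero_add,
    add_mul, Finset.mul_sum]
  have e1 : ∀ z, A i j * A j z * A z i = A i j * (A i z * A j z) := fun z => by
    rw [hs z i]; ring
  have e2 : ∀ z, A i z * A z j * A j i = A i j * (A i z * A j z) := fun z => by
    rw [hs j i, hs z j]; ring
  have e3 : ∀ y z, A j y * A y z * A z j = A j y * A j z * A y z := fun y z => by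
    rw [hs z j]; ring
  have e4 : ∀ y z, A i y * A y z * A z i = A i y * A i z * A y z := fun y z => by
    rw [hs z i]; ring
  simp only [e1, e2, e3, e4]
  simp only [← Finset.mul_sum]
  ring

/-- Ordered triangles are at most ordered paths of length two. -/
lemma triW_le (G : SimpleGraph V) (S : Finset V) :
    triW (adjInd G) S ≤ ∑ x ∈ S, (dg G S x : ℝ) * (dg G S x - 1) := by
  refine Finset.sum_le_sum fun x hx => ?_
  have key : ∀ y ∈ S, ∑ z ∈ S, adjInd G x y * adjInd G y z * adjInd G z x
      ≤ adjInd G x y * (dg G S x - 1) := by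
    intro y hy
    by_cases h : G.Adj x y
    · rw [adjInd_of_adj h, one_mul]
      have h1 := dg_cast_erase G hy x
      rw [adjInd_of_adj h] at h1
      rw [h1, add_sub_cancel_right, dg_cast, ← Finset.sum_erase_add _ _ hy, adjInd_self]
      simp only [one_mul, zero_mul, add_zero]
      refine Finset.sum_le_sum fun z _ => ?_
      rw [adjInd_comm G z x]
      exact mul_le_of_le_one_left (adjInd_nonneg _ _ _) (adjInd_le_one _ _ _)
    · simp [adjInd_of_not_adj h]
  refine (Finset.sum_le_sum key).trans ?_
  rw [← Finset.sum_mul, ← dg_cast]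

/-- Every other degree drops by one, hence the shifted `f`; the triangles through `v` are the edges
of the rest. -/
lemma wt_erase_full {f : ℕ → ℝ} {θ : ℝ} {G : SimpleGraph V} {S : Finset V} {v : V}
    (hv : v ∈ S) (h : dg G S v + 1 = S.card) :
    wt f θ G S = f (dg G S v) + wt (fun x => f (x + 1)) θ G (S.erase v)
      + θ * degSum G (S.erase v) / 2 := by
  have hadj : ∀ x ∈ S.erase v, G.Adj v x := fun x hx =>
    adj_of_dg_full hv h (Finset.mem_of_mem_erase hx) (Finset.ne_of_mem_erase hx)
  unfold wt
  rw [triW_erase (adjInd_self G) (adjInd_comm G) hv, ← Finset.add_sum_erase _ _ hv]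
  have e1 : ∑ x ∈ S.erase v, f (dg G S x) = ∑ x ∈ S.erase v, f (dg G (S.erase v) x + 1) :=
    Finset.sum_congr rfl fun x hx => by rw [dg_erase_of_adj hv (hadj x hx).symm]
  have e2 : ∑ y ∈ S.erase v, ∑ z ∈ S.erase v, adjInd G v y * adjInd G y z * adjInd G z v
      = degSum G (S.erase v) := by
    rw [degSum_cast]
    refine Finset.sum_congr rfl fun y hy => ?_
    rw [dg_cast]
    refine Finset.sum_congr rfl fun z hz => ?_
    rw [adjInd_of_adj (hadj y hy), adjInd_of_adj (hadj z hz).symm]; ring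
  rw [e1, e2]; ring

lemma wt_erase_isolated {f : ℕ → ℝ} {θ : ℝ} {G : SimpleGraph V} {S : Finset V} {v : V}
    (hv : v ∈ S) (h : dg G S v = 0) :
    wt f θ G S = f 0 + wt f θ G (S.erase v) := by
  have hadj : ∀ x ∈ S.erase v, ¬ G.Adj v x := fun x hx =>
    not_adj_of_dg_zero h (Finset.mem_of_mem_erase hx)
  unfold wt
  rw [triW_erase (adjInd_self G) (adjInd_comm G) hv, ← Finset.add_sum_erase _ _ hv, h]
  have e1 : ∑ x ∈ S.erase v, f (dg G S x) = ∑ x ∈ S.erase v, f (dg G (S.erase v) x) :=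
    Finset.sum_congr rfl fun x hx => by
      rw [dg_erase_of_not_adj hv (fun h' => hadj x hx h'.symm)]
  have e2 : ∑ y ∈ S.erase v, ∑ z ∈ S.erase v, adjInd G v y * adjInd G y z * adjInd G z v
      = 0 :=
    Finset.sum_eq_zero fun y hy => Finset.sum_eq_zero fun z _ => by
      rw [adjInd_of_not_adj (hadj y hy)]; ring
  rw [e1, e2]; ring

end Weights

/-! ### Functions with third differences bounded below -/

/-- Monotone convex functions on `ℕ` whose third differences are at least `θ ≥ 0`. -/
structure ThirdConvex (θ : ℝ) (f : ℕ → ℝ) : Prop where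
  nonneg : 0 ≤ θ
  mono : ∀ x, f x ≤ f (x + 1)
  convex : ∀ x, f (x + 1) - f x ≤ f (x + 2) - f (x + 1)
  third : ∀ x, θ ≤ f (x + 3) - 3 * f (x + 2) + 3 * f (x + 1) - f x

namespace ThirdConvex

variable {θ : ℝ} {f : ℕ → ℝ}

lemma shift (hf : ThirdConvex θ f) : ThirdConvex θ (fun x => f (x + 1)) :=
  ⟨hf.nonneg, fun x => hf.mono (x + 1), fun x => hf.convex (x + 1), fun x => hf.third (x + 1)⟩

lemma monotone (hf : ThirdConvex θ f) : Monotone f := monotone_nat_of_le_succ hf.mono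

lemma monotone_diff (hf : ThirdConvex θ f) : Monotone (fun x => f (x + 1) - f x) :=
  monotone_nat_of_le_succ hf.convex

lemma add_le_add_of_spread (hf : ThirdConvex θ f) {p q c : ℕ} :
    f (c + p) + f (c + q) ≤ f (c + p + q) + f c := by
  induction q with
  | zero => simp
  | succ q ih =>
    have := hf.monotone_diff (show c + q ≤ c + p + q by omega)
    simp only [← add_assoc] at *
    linarith

end ThirdConvex

/-! ### Optimal graphs: compression, nested neighbourhoods and edge exchange -/

section Extremal

variable {V : Type*}

/-- The neighbourhoods inside `S` form a chain. -/
def Nested (G : SimpleGraph V) (S : Finset V) : Prop :=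
  ∀ x ∈ S, ∀ y ∈ S, ∀ p ∈ S, ∀ q ∈ S, p ≠ y → q ≠ x → G.Adj x p → G.Adj y q →
    G.Adj y p ∨ G.Adj x q

lemma Nested.mono {G : SimpleGraph V} {S T : Finset V} (h : Nested G S) (hT : T ⊆ S) :
    Nested G T :=
  fun x hx y hy p hp q hq => h x (hT hx) y (hT hy) p (hT hp) q (hT hq)

lemma dg_le_of_imp {G H : SimpleGraph V} {S : Finset V} {x y : V}
    (h : ∀ z ∈ S, G.Adj x z → H.Adj y z) : dg G S x ≤ dg H S y := by
  classical
  refine Finset.card_le_card fun z hz => ?_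
  rw [Finset.mem_filter] at *
  exact ⟨hz.1, h z hz.1 hz.2⟩

/-- The graph `G` maximises first the weight and then the sum of the squared degrees among
the graphs with the same number of edges in `S`. -/
def IsOpt (f : ℕ → ℝ) (θ : ℝ) (G : SimpleGraph V) (S : Finset V) : Prop :=
  ∀ H : SimpleGraph V, degSum H S = degSum G S →
    wt f θ H S < wt f θ G S ∨ (wt f θ H S = wt f θ G S ∧ degSq H S ≤ degSq G S)

/-- The tie-break is needed because the weight need not be strictly convex in the degrees: `C(x, t)`
vanishes for small `x`, so a compression may leave the weight unchanged. -/
lemma exists_isOpt [Finite V] (f : ℕ → ℝ) (θ : ℝ) (G : SimpleGraph V) (S : Finset V) :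
    ∃ H : SimpleGraph V, degSum H S = degSum G S ∧ wt f θ G S ≤ wt f θ H S ∧
      IsOpt f θ H S := by
  let K := {H : SimpleGraph V // degSum H S = degSum G S}
  have : Nonempty K := ⟨⟨G, rfl⟩⟩
  obtain ⟨H, hH⟩ := Finite.exists_max
    (fun H : K => toLex ((wt f θ H.1 S, degSq H.1 S) : ℝ × ℕ))
  refine ⟨H.1, H.2, ?_, fun H' h' => ?_⟩
  · have := hH ⟨G, rfl⟩
    rw [Prod.Lex.toLex_le_toLex] at this
    rcases this with h | h
    · exact h.le
    · exact h.1.le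
  · have := hH ⟨H', h'.trans H.2⟩
    rwa [Prod.Lex.toLex_le_toLex] at this

lemma IsOpt.not_better {f : ℕ → ℝ} {θ : ℝ} {G H : SimpleGraph V} {S : Finset V}
    (hG : IsOpt f θ G S) (hd : degSum H S = degSum G S) (hw : wt f θ G S ≤ wt f θ H S)
    (hs : degSq G S < degSq H S) : False := by
  rcases hG H hd with h | h
  · exact absurd hw (not_le.2 h)
  · exact absurd hs (not_lt.2 h.2)

/-- The graphs `G` and `H` differ exactly in the edge `xy` of `G`. -/
structure DiffAt (H G : SimpleGraph V) (x y : V) : Prop where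
  ne : x ≠ y
  adj : G.Adj x y
  not_adj : ¬ H.Adj x y
  iff : ∀ p q, s(p, q) ≠ s(x, y) → (H.Adj p q ↔ G.Adj p q)

namespace DiffAt

variable {G H : SimpleGraph V} {x y : V} {S : Finset V}


lemma symm (h : DiffAt H G x y) : DiffAt H G y x :=
  ⟨h.ne.symm, h.adj.symm, fun h' => h.not_adj h'.symm,
    fun p q hpq => h.iff p q (fun e => hpq (e.trans Sym2.eq_swap))⟩

lemma adjInd_eq (h : DiffAt H G x y) {p q : V} (hpq : s(p, q) ≠ s(x, y)) :
    adjInd H p q = adjInd G p q :=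
  adjInd_congr (h.iff p q hpq)

lemma deleteEdges {x y : V} (h : G.Adj x y) : DiffAt (G.deleteEdges {s(x, y)}) G x y :=
  ⟨h.ne, h, by simp, fun p q hpq => by
    rw [SimpleGraph.deleteEdges_adj, Set.mem_singleton_iff]; exact and_iff_left hpq⟩

lemma sup_edge {x y : V} (hne : x ≠ y) (h : ¬ G.Adj x y) :
    DiffAt G (G ⊔ SimpleGraph.edge x y) x y :=
  ⟨hne, by simp [SimpleGraph.edge_adj, hne], h, fun p q hpq => by
    rw [Ne, Sym2.eq_iff] at hpq
    simp only [SimpleGraph.sup_adj, SimpleGraph.edge_adj]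
    tauto⟩

end DiffAt

variable [DecidableEq V]

/-- In a graph with nested neighbourhoods, a non-neighbour of a vertex of maximum degree is
isolated. -/
lemma Nested.isolated {G : SimpleGraph V} {S : Finset V} (h : Nested G S) {v w : V}
    (hv : v ∈ S) (hmax : ∀ x ∈ S, dg G S x ≤ dg G S v) (hw : w ∈ S) (hwv : w ≠ v)
    (hadj : ¬ G.Adj v w) : dg G S w = 0 := by
  by_contra h0
  obtain ⟨x, hx⟩ : ∃ x ∈ S, G.Adj w x := by
    by_contra hn
    push Not at hn
    apply h0
    classical
    unfold dg
    rw [Finset.card_eq_zero, Finset.filter_eq_empty_iff]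
    exact fun y hy => hn y hy
  obtain ⟨hx, hwx⟩ := hx
  have hxv : x ≠ v := fun e => hadj (e ▸ hwx.symm)
  -- As `w` is adjacent to `x` but not to `v`, nestedness puts all other neighbours of `v` among
  -- those of `x`. With `w` in addition, `x` has larger degree than `v`, a contradiction.
  have hsub : ∀ q ∈ S, q ≠ x → G.Adj v q → G.Adj x q := fun q hq hqx hvq =>
    (h x hx v hv w hw q hq hwv hqx hwx.symm hvq).resolve_left hadj
  have hle := hmax x hx
  have hw1 := dg_erase_of_adj hw hwx.symm
  have hw2 := dg_erase_of_not_adj hw hadj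
  by_cases hvx : G.Adj v x
  · have hx' : x ∈ S.erase w := Finset.mem_erase.2 ⟨hwx.ne', hx⟩
    have hv' : v ∈ S.erase w := Finset.mem_erase.2 ⟨hwv.symm, hv⟩
    have h1 := dg_erase_of_adj hx' hvx
    have h2 := dg_erase_of_adj hv' hvx.symm
    have h3 : dg G ((S.erase w).erase x) v ≤ dg G ((S.erase w).erase v) x := by
      classical
      refine Finset.card_le_card fun z hz => ?_
      simp only [Finset.mem_filter, Finset.mem_erase] at *
      exact ⟨⟨hz.2.ne', hz.1.2⟩, hsub z hz.1.2.2 hz.1.1 hz.2⟩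
    omega
  · have h3 : dg G (S.erase w) v ≤ dg G (S.erase w) x := dg_le_of_imp
      fun z hz hvz => hsub z (Finset.mem_of_mem_erase hz) (fun e => hvx (e ▸ hvz)) hvz
    omega

/-- A vertex of maximum degree is full, or it has a non-neighbour, which is isolated. -/
lemma Nested.exists_isolated_or_full {G : SimpleGraph V} {S : Finset V} (h : Nested G S)
    (hS : S.Nonempty) : ∃ v ∈ S, dg G S v = 0 ∨ dg G S v + 1 = S.card := by
  obtain ⟨v, hv, hmax⟩ := Finset.exists_max_image S (dg G S) hS
  by_cases hfull : ∀ w ∈ S, w ≠ v → G.Adj v w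
  · refine ⟨v, hv, Or.inr ?_⟩
    classical
    rw [dg_erase_self hv, ← Finset.card_erase_add_one hv]
    unfold dg
    rw [Finset.filter_true_of_mem]
    exact fun w hw => hfull w (Finset.mem_of_mem_erase hw) (Finset.ne_of_mem_erase hw)
  · push Not at hfull
    obtain ⟨w, hw, hwv, hn⟩ := hfull
    exact ⟨w, hw, Or.inl (h.isolated hv hmax hw hwv hn)⟩

/-- The compression of a graph that moves neighbours of `j` to `i`. -/
def compress (G : SimpleGraph V) (i j : V) : SimpleGraph V where
  Adj x y := x ≠ y ∧
    if x = i then (if y = j then G.Adj i j else G.Adj i y ∨ G.Adj j y)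
    else if x = j then (if y = i then G.Adj i j else G.Adj i y ∧ G.Adj j y)
    else if y = i then G.Adj i x ∨ G.Adj j x
    else if y = j then G.Adj i x ∧ G.Adj j x
    else G.Adj x y
  symm := ⟨fun x y h => ⟨h.1.symm, by
    obtain ⟨hne, h⟩ := h
    split_ifs at h ⊢ <;> simp_all [G.adj_comm]⟩⟩
  loopless := ⟨fun _ h => h.1 rfl⟩

lemma compress_adj_pair {G : SimpleGraph V} {i j : V} (hij : i ≠ j) :
    (compress G i j).Adj i j ↔ G.Adj i j := by
  simp [compress, hij]

lemma compress_adj_left {G : SimpleGraph V} {i j y : V} (hi : y ≠ i) (hj : y ≠ j) :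
    (compress G i j).Adj i y ↔ G.Adj i y ∨ G.Adj j y := by
  simp [compress, hi.symm, hj]

lemma compress_adj_right {G : SimpleGraph V} {i j y : V} (hij : i ≠ j) (hi : y ≠ i)
    (hj : y ≠ j) : (compress G i j).Adj j y ↔ G.Adj i y ∧ G.Adj j y := by
  simp [compress, hi, hj.symm, hij.symm]

lemma compress_adj_rest {G : SimpleGraph V} {i j x y : V} (hxi : x ≠ i) (hxj : x ≠ j)
    (hyi : y ≠ i) (hyj : y ≠ j) : (compress G i j).Adj x y ↔ G.Adj x y := by
  simp only [compress, hxi, hxj, hyi, hyj, if_false, and_iff_right_iff_imp]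
  exact fun h => h.ne

lemma sum_insert_pair {M : Type*} [AddCommMonoid M] {R : Finset V} {i j : V} (hij : i ≠ j)
    (hi : i ∉ R) (hj : j ∉ R) (g : V → M) :
    ∑ x ∈ insert i (insert j R), g x = g i + (g j + ∑ x ∈ R, g x) := by
  rw [Finset.sum_insert (by simp [hij, hi]), Finset.sum_insert hj]

/-- Optimal graphs have nested neighbourhoods. -/
lemma IsOpt.nested {f : ℕ → ℝ} {θ : ℝ} (hf : ThirdConvex θ f) {G : SimpleGraph V}
    {S : Finset V} (hG : IsOpt f θ G S) : Nested G S := by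
  intro i hi j hj p hp q hq hpj hqi hip hjq
  by_contra hcon
  push Not at hcon
  obtain ⟨hjp, hiq⟩ := hcon
  have hij : i ≠ j := fun e => hjp (e ▸ hip)
  have hpi : p ≠ i := hip.ne'
  have hqj : q ≠ j := hjq.ne'
  obtain ⟨R, hR⟩ : ∃ R, R = (S.erase i).erase j := ⟨_, rfl⟩
  have hSR : insert i (insert j R) = S := by
    rw [hR, Finset.insert_erase (Finset.mem_erase.2 ⟨hij.symm, hj⟩), Finset.insert_erase hi]
  have hiR : i ∉ R := by simp [hR]
  have hjR : j ∉ R := by simp [hR]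
  have hRne : ∀ x ∈ R, x ≠ i ∧ x ≠ j := fun x hx =>
    ⟨fun e => hiR (e ▸ hx), fun e => hjR (e ▸ hx)⟩
  have hpR : p ∈ R := by simp [hR, hpi, hpj, hp]
  have hqR : q ∈ R := by simp [hR, hqi, hqj, hq]
  have hsum : ∀ g : V → ℝ, ∑ x ∈ S, g x = g i + (g j + ∑ x ∈ R, g x) := fun g => by
    rw [← hSR, sum_insert_pair hij hiR hjR]
  have hsumN : ∀ g : V → ℕ, ∑ x ∈ S, g x = g i + (g j + ∑ x ∈ R, g x) := fun g => by
    rw [← hSR, sum_insert_pair hij hiR hjR]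
  obtain ⟨H, hH⟩ : ∃ H, H = compress G i j := ⟨_, rfl⟩
  have aij : adjInd H i j = adjInd G i j := by
    rw [hH]; exact adjInd_congr (compress_adj_pair hij)
  have aR : ∀ x ∈ R, ∀ y ∈ R, adjInd H x y = adjInd G x y := fun x hx y hy => by
    rw [hH]
    exact adjInd_congr
      (compress_adj_rest (hRne x hx).1 (hRne x hx).2 (hRne y hy).1 (hRne y hy).2)
  have ai : ∀ x ∈ R, adjInd H i x = max (adjInd G i x) (adjInd G j x) := fun x hx => by
    have h := compress_adj_left (G := G) (hRne x hx).1 (hRne x hx).2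
    rw [← hH] at h
    by_cases h1 : G.Adj i x <;> by_cases h2 : G.Adj j x <;> simp [adjInd, h, h1, h2]
  have aj : ∀ x ∈ R, adjInd H j x = min (adjInd G i x) (adjInd G j x) := fun x hx => by
    have h := compress_adj_right (G := G) hij (hRne x hx).1 (hRne x hx).2
    rw [← hH] at h
    by_cases h1 : G.Adj i x <;> by_cases h2 : G.Adj j x <;> simp [adjInd, h, h1, h2]
  have asum : ∀ x ∈ R, adjInd H i x + adjInd H j x = adjInd G i x + adjInd G j x :=
    fun x hx => by rw [ai x hx, aj x hx, max_add_min]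
  have dexp : ∀ (K : SimpleGraph V) x, (dg K S x : ℝ)
      = adjInd K x i + (adjInd K x j + ∑ y ∈ R, adjInd K x y) := fun K x => by
    rw [dg_cast, hsum]
  have dR : ∀ x ∈ R, dg H S x = dg G S x := fun x hx => by
    have : (dg H S x : ℝ) = dg G S x := by
      rw [dexp, dexp, Finset.sum_congr rfl (aR x hx), adjInd_comm H x i, adjInd_comm H x j,
        adjInd_comm G x i, adjInd_comm G x j]
      linarith [asum x hx]
    exact_mod_cast this
  have dsum : dg H S i + dg H S j = dg G S i + dg G S j := by
    have : (dg H S i : ℝ) + dg H S j = dg G S i + dg G S j := by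
      simp only [dexp, adjInd_self, adjInd_comm _ j i, aij]
      have := Finset.sum_congr rfl asum
      simp only [Finset.sum_add_distrib] at this
      linarith
    exact_mod_cast this
  have hdi : dg G S i < dg H S i := by
    have : (dg G S i : ℝ) < dg H S i := by
      simp only [dexp, adjInd_self, aij]
      have : ∑ y ∈ R, adjInd G i y < ∑ y ∈ R, adjInd H i y := by
        refine Finset.sum_lt_sum (fun x hx => ?_) ⟨q, hqR, ?_⟩
        · rw [ai x hx]; exact le_max_left _ _
        · rw [ai q hqR, adjInd_of_not_adj hiq, adjInd_of_adj hjq]; norm_num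
      linarith
    exact_mod_cast this
  have hdj : dg G S j < dg H S i := by
    have : (dg G S j : ℝ) < dg H S i := by
      simp only [dexp, adjInd_self, aij, adjInd_comm _ j i]
      have : ∑ y ∈ R, adjInd G j y < ∑ y ∈ R, adjInd H i y := by
        refine Finset.sum_lt_sum (fun x hx => ?_) ⟨p, hpR, ?_⟩
        · rw [ai x hx]; exact le_max_right _ _
        · rw [ai p hpR, adjInd_of_not_adj hjp, adjInd_of_adj hip]; norm_num
      linarith
    exact_mod_cast this
  -- Compression turns the degrees `c + a`, `c + b` of `i`, `j` into `c + a + b`, `c`. This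
  -- increases the sum of squares by `2ab`, and `a`, `b` are positive because of `p` and `q`.
  obtain ⟨a, ha⟩ : ∃ a, dg G S i = dg H S j + a := ⟨dg G S i - dg H S j, by omega⟩
  obtain ⟨b, hb⟩ : ∃ b, dg G S j = dg H S j + b := ⟨dg G S j - dg H S j, by omega⟩
  have hc : dg H S i = dg H S j + a + b := by omega
  have ha0 : 0 < a := by omega
  have hb0 : 0 < b := by omega
  refine hG.not_better (H := H) ?_ ?_ ?_
  · unfold degSum
    have e0 : R.sum (dg H S) = R.sum (dg G S) := Finset.sum_congr rfl dR
    have e1 : S.sum (dg H S) = dg H S i + (dg H S j + R.sum (dg H S)) := hsumN _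
    have e2 : S.sum (dg G S) = dg G S i + (dg G S j + R.sum (dg G S)) := hsumN _
    change S.sum (dg H S) = S.sum (dg G S)
    omega
  · unfold wt
    have h1 : ∑ x ∈ S, f (dg G S x) ≤ ∑ x ∈ S, f (dg H S x) := by
      rw [hsum, hsum, Finset.sum_congr rfl fun x hx => congrArg f (dR x hx), hc, ha, hb]
      have := hf.add_le_add_of_spread (p := a) (q := b) (c := dg H S j)
      linarith
    have h2 : triW (adjInd G) S ≤ triW (adjInd H) S := by
      rw [← hSR, triW_pair (adjInd_self G) (adjInd_comm G) hij hiR hjR,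
        triW_pair (adjInd_self H) (adjInd_comm H) hij hiR hjR, aij]
      have e0 : triW (adjInd H) R = triW (adjInd G) R := by
        refine Finset.sum_congr rfl fun x hx => Finset.sum_congr rfl fun y hy =>
          Finset.sum_congr rfl fun z hz => ?_
        rw [aR x hx y hy, aR y hy z hz, aR z hz x hx]
      have e1 : ∑ z ∈ R, adjInd H i z * adjInd H j z = ∑ z ∈ R, adjInd G i z * adjInd G j z :=
        Finset.sum_congr rfl fun z hz => by rw [ai z hz, aj z hz, max_mul_min]
      -- Triangles with exactly one of `i`, `j`: a pair inside either neighbourhood lies inside the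
      -- union, and a pair inside both lies inside the intersection as well.
      have e2 : ∑ y ∈ R, ∑ z ∈ R,
            (adjInd G i y * adjInd G i z + adjInd G j y * adjInd G j z) * adjInd G y z
          ≤ ∑ y ∈ R, ∑ z ∈ R,
            (adjInd H i y * adjInd H i z + adjInd H j y * adjInd H j z) * adjInd H y z := by
        refine Finset.sum_le_sum fun y hy => Finset.sum_le_sum fun z hz => ?_
        rw [aR y hy z hz]
        refine mul_le_mul_of_nonneg_right ?_ (adjInd_nonneg _ _ _)
        rw [ai y hy, ai z hz, aj y hy, aj z hz]
        simp only [adjInd]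
        split_ifs <;> norm_num
      rw [e0, e1]
      linarith
    have := mul_le_mul_of_nonneg_left h2 hf.nonneg
    linarith
  · unfold degSq
    rw [hsumN, hsumN, Finset.sum_congr rfl fun x hx => congrArg (· ^ 2) (dR x hx), hc, ha, hb]
    nlinarith [Nat.mul_pos ha0 hb0]

namespace DiffAt

variable {G H : SimpleGraph V} {x y : V} {S : Finset V}

lemma dg_left (h : DiffAt H G x y) (hy : y ∈ S) : dg G S x = dg H S x + 1 := by
  have : (dg G S x : ℝ) = dg H S x + 1 := by
    rw [dg_cast_erase _ hy, dg_cast_erase _ hy, adjInd_of_adj h.adj,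
      adjInd_of_not_adj h.not_adj, dg_cast, dg_cast, add_zero]
    congr 1
    refine Finset.sum_congr rfl fun z hz => (h.adjInd_eq fun e => ?_).symm
    simp only [Sym2.eq_iff, true_and] at e
    rcases e with e | e
    · exact Finset.ne_of_mem_erase hz e
    · exact h.ne e.1
  exact_mod_cast this

lemma dg_other (h : DiffAt H G x y) {z : V} (hzx : z ≠ x) (hzy : z ≠ y) :
    dg H S z = dg G S z := by
  have : (dg H S z : ℝ) = dg G S z := by
    rw [dg_cast, dg_cast]
    refine Finset.sum_congr rfl fun p _ => h.adjInd_eq fun e => ?_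
    simp only [Sym2.eq_iff, hzx, hzy, false_and, or_self] at e
  exact_mod_cast this

lemma exists_rest (h : DiffAt H G x y) (hx : x ∈ S) (hy : y ∈ S) :
    ∃ R : Finset V, insert x (insert y R) = S ∧ x ∉ R ∧ y ∉ R :=
  ⟨(S.erase x).erase y, by
    rw [Finset.insert_erase (Finset.mem_erase.2 ⟨h.ne.symm, hy⟩), Finset.insert_erase hx],
    by simp, by simp⟩

lemma sum_dg {M : Type*} [AddCommMonoid M] (h : DiffAt H G x y) (hx : x ∈ S) (hy : y ∈ S)
    (f : ℕ → M) :
    ∑ z ∈ S, f (dg G S z) + (f (dg H S x) + f (dg H S y))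
      = ∑ z ∈ S, f (dg H S z) + (f (dg H S x + 1) + f (dg H S y + 1)) := by
  obtain ⟨R, hR, hxR, hyR⟩ := h.exists_rest hx hy
  have e : ∀ g : V → M, ∑ z ∈ S, g z = g x + (g y + ∑ z ∈ R, g z) := fun g => by
    rw [← hR, sum_insert_pair h.ne hxR hyR]
  rw [e, e, Finset.sum_congr rfl fun z hz => congrArg f
    (h.dg_other (S := S) (fun e => hxR (e ▸ hz)) (fun e => hyR (e ▸ hz))),
    h.dg_left hy, h.symm.dg_left hx]
  abel

lemma degSum_eq (h : DiffAt H G x y) (hx : x ∈ S) (hy : y ∈ S) :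
    degSum G S = degSum H S + 2 := by
  have := h.sum_dg hx hy id
  simp only [id] at this
  unfold degSum
  omega

/-- The triangles lost with `xy` correspond to common neighbours of `x` and `y`, all still
neighbours of `x` in `H`; each triangle is counted in six orders. -/
lemma triW_eq (h : DiffAt H G x y) (hx : x ∈ S) (hy : y ∈ S) :
    triW (adjInd H) S ≤ triW (adjInd G) S ∧
      triW (adjInd G) S ≤ triW (adjInd H) S + 6 * dg H S x := by
  obtain ⟨R, hR, hxR, hyR⟩ := h.exists_rest hx hy
  have hne : ∀ z ∈ R, ∀ p, s(z, p) ≠ s(x, y) := fun z hz p e => by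
    simp only [Sym2.eq_iff] at e
    rcases e with e | e
    · exact hxR (e.1 ▸ hz)
    · exact hyR (e.1 ▸ hz)
  have aR : ∀ z ∈ R, ∀ p, adjInd H z p = adjInd G z p := fun z hz p => h.adjInd_eq (hne z hz p)
  have aR' : ∀ z ∈ R, ∀ p, adjInd H p z = adjInd G p z := fun z hz p => by
    rw [adjInd_comm H, adjInd_comm G, aR z hz]
  have e0 : triW (adjInd H) R = triW (adjInd G) R :=
    Finset.sum_congr rfl fun p hp => Finset.sum_congr rfl fun q hq =>
      Finset.sum_congr rfl fun z hz => by rw [aR p hp, aR q hq, aR z hz]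
  have e1 : ∑ p ∈ R, ∑ q ∈ R,
        (adjInd H x p * adjInd H x q + adjInd H y p * adjInd H y q) * adjInd H p q
      = ∑ p ∈ R, ∑ q ∈ R,
        (adjInd G x p * adjInd G x q + adjInd G y p * adjInd G y q) * adjInd G p q :=
    Finset.sum_congr rfl fun p hp => Finset.sum_congr rfl fun q hq => by
      rw [aR' p hp, aR' p hp, aR' q hq, aR' q hq, aR' q hq]
  have e2 : 0 ≤ ∑ z ∈ R, adjInd G x z * adjInd G y z :=
    Finset.sum_nonneg fun z _ => mul_nonneg (adjInd_nonneg _ _ _) (adjInd_nonneg _ _ _)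
  have e3 : ∑ z ∈ R, adjInd G x z * adjInd G y z ≤ dg H S x := by
    rw [dg_cast]
    calc ∑ z ∈ R, adjInd G x z * adjInd G y z ≤ ∑ z ∈ R, adjInd H x z :=
          Finset.sum_le_sum fun z hz => by
            rw [aR' z hz]
            exact mul_le_of_le_one_right (adjInd_nonneg _ _ _) (adjInd_le_one _ _ _)
      _ ≤ ∑ z ∈ S, adjInd H x z :=
          Finset.sum_le_sum_of_subset_of_nonneg
            (fun z hz => hR ▸ Finset.mem_insert_of_mem (Finset.mem_insert_of_mem hz))
            (fun z _ _ => adjInd_nonneg _ _ _)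
  have eG := triW_pair (adjInd_self G) (adjInd_comm G) h.ne hxR hyR
  have eH := triW_pair (adjInd_self H) (adjInd_comm H) h.ne hxR hyR
  rw [hR] at eG eH
  rw [adjInd_of_adj h.adj] at eG
  rw [adjInd_of_not_adj h.not_adj, e0, e1] at eH
  constructor <;> linarith

end DiffAt

/-- In an optimal graph no edge joins two vertices of small degree, if some vertex of large
degree misses a vertex. -/
lemma IsOpt.not_small_edge {f : ℕ → ℝ} {θ : ℝ} (hf : ThirdConvex θ f) {G : SimpleGraph V}
    {S : Finset V} (hG : IsOpt f θ G S) {v w x y : V} {k : ℕ} (hv : v ∈ S) (hw : w ∈ S)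
    (hx : x ∈ S) (hy : y ∈ S) (hwv : w ≠ v) (hw0 : dg G S w = 0) (hxy : G.Adj x y)
    (hxv : x ≠ v) (hyv : y ≠ v) (hxk : dg G S x ≤ k + 1) (hyk : dg G S y ≤ k + 1)
    (hgain : 2 * (f (k + 1) - f k) + θ * k < f (dg G S v + 1) - f (dg G S v)) : False := by
  have hxw : x ≠ w := fun e => not_adj_of_dg_zero hw0 hy (e ▸ hxy)
  have hyw : y ≠ w := fun e => not_adj_of_dg_zero hw0 hx (e ▸ hxy.symm)
  obtain ⟨G₁, hG₁⟩ : ∃ G₁, G₁ = G.deleteEdges {s(x, y)} := ⟨_, rfl⟩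
  have d1 : DiffAt G₁ G x y := hG₁ ▸ DiffAt.deleteEdges hxy
  have hv1 : dg G₁ S v = dg G S v := d1.dg_other hxv.symm hyv.symm
  have hw1 : dg G₁ S w = dg G S w := d1.dg_other hxw.symm hyw.symm
  have hvw : ¬ G₁.Adj v w := fun h => not_adj_of_dg_zero (hw1.trans hw0) hv h.symm
  have d2 : DiffAt G₁ (G₁ ⊔ SimpleGraph.edge v w) v w := DiffAt.sup_edge hwv.symm hvw
  set H := G₁ ⊔ SimpleGraph.edge v w
  have s1 := d1.sum_dg hx hy f
  have s2 := d2.sum_dg hv hw f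
  have t1 := (d1.triW_eq hx hy).2
  have t2 := (d2.triW_eq hv hw).1
  have hx1 := d1.dg_left (S := S) hy
  have hy1 := d1.symm.dg_left (S := S) hx
  have hle : wt f θ H S ≤ wt f θ G S := by
    rcases hG H (by have := d1.degSum_eq hx hy; have := d2.degSum_eq hv hw; omega) with h | h
    · exact h.le
    · exact h.1.le
  have m1 := hf.monotone_diff (show dg G₁ S x ≤ k by omega)
  have m2 := hf.monotone_diff (show dg G₁ S y ≤ k by omega)
  -- The gain `f 1 - f 0` at `w` and any triangles created by `vw` are discarded.
  have m3 := hf.mono 0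
  have ht : triW (adjInd G) S - 6 * k ≤ triW (adjInd H) S := by
    have : (dg G₁ S x : ℝ) ≤ k := by exact_mod_cast (show dg G₁ S x ≤ k by omega)
    linarith
  have ht' := mul_le_mul_of_nonneg_left ht hf.nonneg
  unfold wt at hle
  rw [hv1, hw1, hw0] at s2
  simp only at m1 m2
  simp only [zero_add] at *
  linarith

end Extremal

/-! ### Growth of functions with large third differences -/

namespace ThirdConvex

variable {θ : ℝ} {f : ℕ → ℝ}

/-- Second differences grow by at least `θ` per step, so the rise of the first difference over a
window of length `k` grows by at least `θ k p` when the window moves by `p`. -/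
lemma gap (hf : ThirdConvex θ f) (i p k : ℕ) :
    f (i + k + 1) - f (i + k) - (f (i + 1) - f i) + θ * k * p
      ≤ f (i + p + k + 1) - f (i + p + k) - (f (i + p + 1) - f (i + p)) := by
  have h2 : ∀ x p, f (x + 2) - 2 * f (x + 1) + f x + θ * p
      ≤ f (x + p + 2) - 2 * f (x + p + 1) + f (x + p) := by
    intro x p
    induction p with
    | zero => simp
    | succ p ih =>
      have := hf.third (x + p)
      push_cast
      rw [show x + (p + 1) = x + p + 1 by ring]
      rw [show x + p + 1 + 2 = x + p + 3 by ring, show x + p + 1 + 1 = x + p + 2 by ring]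
      linarith
  induction k with
  | zero => simp
  | succ k ih =>
    have := h2 (i + k) p
    rw [show i + k + p = i + p + k by ring] at this
    push_cast
    rw [show i + (k + 1) = i + k + 1 by ring, show i + p + (k + 1) = i + p + k + 1 by ring,
      show i + k + 1 + 1 = i + k + 2 by ring, show i + p + k + 1 + 1 = i + p + k + 2 by ring]
    linarith

/-- The excess of `f` over its linear part is superquadratic. -/
lemma excess_succ (hf : ThirdConvex θ f) (d : ℕ) :
    (d + 1) * (f d - f 0 - d * (f 1 - f 0)) + θ * ((d + 1) * d * (d - 1)) / 6
      ≤ (d - 1) * (f (d + 1) - f 0 - (d + 1) * (f 1 - f 0)) := by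
  have h1 : ∀ d : ℕ, f (d + 1) - f d - (f 1 - f 0) + θ * (d * (d + 1)) / 2
      ≤ d * (f (d + 2) - 2 * f (d + 1) + f d) := by
    intro d
    induction d with
    | zero => simp
    | succ d ih =>
      have h3 := hf.third d
      have h4 := mul_le_mul_of_nonneg_left h3 (show (0 : ℝ) ≤ d + 1 by positivity)
      push_cast
      rw [show d + 1 + 2 = d + 3 by ring, show d + 1 + 1 = d + 2 by ring]
      linarith
  induction d with
  | zero => simp
  | succ d ih =>
    have := h1 d
    push_cast at *
    rw [show d + 1 + 1 = d + 2 by ring]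
    linarith

lemma excess_nonneg (hf : ThirdConvex θ f) (d : ℕ) : 0 ≤ f d - f 0 - d * (f 1 - f 0) := by
  induction d with
  | zero => simp
  | succ d ih =>
    have := hf.monotone_diff (Nat.zero_le d)
    simp only [zero_add] at this
    push_cast
    linarith

/-- By `excess_succ` the ratio of the excess to `d(d-1)` is nondecreasing. -/
lemma excess_le (hf : ThirdConvex θ f) {d m : ℕ} (hdm : d ≤ m) :
    (f d - f 0 - d * (f 1 - f 0)) * (m * (m - 1))
      ≤ d * (d - 1) * (f m - f 0 - m * (f 1 - f 0)) := by
  rcases Nat.eq_zero_or_pos d with rfl | hd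
  · simp
  rcases Nat.eq_or_lt_of_le hd with rfl | hd2
  · simp
  induction m, hdm using Nat.le_induction with
  | base => linarith
  | succ m hm ih =>
    have h := hf.excess_succ m
    have hm1 : (0 : ℝ) < m - 1 := by
      have : (2 : ℝ) ≤ m := by exact_mod_cast (by omega : 2 ≤ m)
      linarith
    have hθ : 0 ≤ θ * (((m : ℝ) + 1) * m * (m - 1)) / 6 := by
      have := hf.nonneg; positivity
    have hdd : (0 : ℝ) ≤ d * (d - 1) := by
      have : (1 : ℝ) ≤ d := by exact_mod_cast hd
      exact mul_nonneg (by linarith) (by linarith)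
    refine le_of_mul_le_mul_right ?_ hm1
    push_cast
    have h5 := mul_le_mul_of_nonneg_left ((le_add_of_nonneg_right hθ).trans h) hdd
    have h6 := mul_le_mul_of_nonneg_left ih (show (0 : ℝ) ≤ m + 1 by positivity)
    linarith

/-- For `d < m` one step of `excess_succ` leaves `θ/6` to spare in the ratio; this pays for the
triangles in `wt_le_star`. -/
lemma excess_lt (hf : ThirdConvex θ f) {d m : ℕ} (hdm : d < m) :
    (f d - f 0 - d * (f 1 - f 0) + θ * (d * (d - 1)) / 6) * (m * (m - 1))
      ≤ d * (d - 1) * (f m - f 0 - m * (f 1 - f 0)) := by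
  rcases Nat.eq_zero_or_pos d with rfl | hd
  · simp
  have h := hf.excess_le (show d + 1 ≤ m from hdm)
  have h1 := hf.excess_succ d
  have hd0 : (0 : ℝ) < d := by exact_mod_cast hd
  have hd1 : (1 : ℝ) ≤ d := by exact_mod_cast hd
  have hm : (0 : ℝ) ≤ m * (m - 1) := by
    have : (1 : ℝ) ≤ m := by exact_mod_cast (by omega : 1 ≤ m)
    exact mul_nonneg (by linarith) (by linarith)
  have h2 := mul_le_mul_of_nonneg_right h1 hm
  push_cast at h
  have h3 := mul_le_mul_of_nonneg_left h (show (0 : ℝ) ≤ d - 1 by linarith)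
  refine le_of_mul_le_mul_right ?_ (show (0 : ℝ) < d + 1 by positivity)
  linarith

end ThirdConvex

/-! ### The star bound -/

section Star

variable {V : Type*} [DecidableEq V]

lemma dg_le_of_degSum {G : SimpleGraph V} {S : Finset V} {m : ℕ} (h : degSum G S = 2 * m)
    {v : V} (hv : v ∈ S) : dg G S v ≤ m := by
  have := degSum_erase G hv
  omega

lemma dg_add_dg_le {G : SimpleGraph V} {S : Finset V} {m : ℕ} (h : degSum G S = 2 * m)
    {v w : V} (hv : v ∈ S) (hw : w ∈ S) (hvw : G.Adj v w) : dg G S v + dg G S w ≤ m + 1 := by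
  have h1 := degSum_erase G hv
  have h2 := degSum_erase G (S := S.erase v) (Finset.mem_erase.2 ⟨hvw.ne', hw⟩)
  have h3 := dg_erase_of_adj hv hvw.symm
  omega

/-- The sum of squared degrees is the sum of `d(v) + d(w)` over the edges `vw`, and each term is at
most `m + 1`. -/
lemma sum_dg_sq_le {G : SimpleGraph V} {S : Finset V} {m : ℕ} (h : degSum G S = 2 * m) :
    ∑ v ∈ S, (dg G S v : ℝ) * (dg G S v - 1) ≤ m * (m - 1) := by
  have e1 : ∑ v ∈ S, (dg G S v : ℝ) * dg G S v
      = ∑ v ∈ S, ∑ w ∈ S, adjInd G v w * dg G S v :=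
    Finset.sum_congr rfl fun v _ => by rw [← Finset.sum_mul, ← dg_cast]
  have e2 : ∑ v ∈ S, (dg G S v : ℝ) * dg G S v
      = ∑ v ∈ S, ∑ w ∈ S, adjInd G v w * dg G S w := by
    rw [e1, Finset.sum_comm]
    exact Finset.sum_congr rfl fun v _ => Finset.sum_congr rfl fun w _ => by
      rw [adjInd_comm]
  have e3 : ∑ v ∈ S, (dg G S v : ℝ) = 2 * m := by
    rw [← degSum_cast, h]; push_cast; ring
  have e4 : ∑ v ∈ S, ∑ w ∈ S, adjInd G v w * dg G S v
      + ∑ v ∈ S, ∑ w ∈ S, adjInd G v w * dg G S w ≤ 2 * m * (m + 1) := by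
    rw [← e3, Finset.sum_mul, ← Finset.sum_add_distrib]
    refine Finset.sum_le_sum fun v hv => ?_
    rw [← Finset.sum_add_distrib, dg_cast G S v, Finset.sum_mul]
    refine Finset.sum_le_sum fun w hw => ?_
    by_cases hvw : G.Adj v w
    · rw [adjInd_of_adj hvw, one_mul, one_mul, one_mul, ← dg_cast]
      exact_mod_cast dg_add_dg_le h hv hw hvw
    · simp [adjInd_of_not_adj hvw]
  simp only [mul_sub, mul_one, Finset.sum_sub_distrib]
  rw [e3]
  linarith

/-- Among the graphs with few edges the star has the largest weight. -/
lemma wt_le_star {f : ℕ → ℝ} {θ : ℝ} (hf : ThirdConvex θ f) {G : SimpleGraph V}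
    {S : Finset V} {m : ℕ} (h : degSum G S = 2 * m) :
    wt f θ G S ≤ f m + m * f 1 + (S.card - 1 - m) * f 0 := by
  have e3 : ∑ v ∈ S, (dg G S v : ℝ) = 2 * m := by
    rw [← degSum_cast, h]; push_cast; ring
  have hT : θ * triW (adjInd G) S / 6 ≤ ∑ v ∈ S, θ * ((dg G S v : ℝ) * (dg G S v - 1)) / 6 := by
    rw [← Finset.sum_div, ← Finset.mul_sum]
    have := mul_le_mul_of_nonneg_left (triW_le G S) hf.nonneg
    linarith
  have hsplit : ∑ v ∈ S, f (dg G S v) = ∑ v ∈ S, (f (dg G S v) - f 0 - dg G S v * (f 1 - f 0))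
      + S.card * f 0 + 2 * m * (f 1 - f 0) := by
    rw [← e3, Finset.sum_mul]
    simp only [Finset.sum_sub_distrib, Finset.sum_const, nsmul_eq_mul]
    ring
  have key : ∑ v ∈ S, (f (dg G S v) - f 0 - dg G S v * (f 1 - f 0))
      + θ * triW (adjInd G) S / 6 ≤ f m - f 0 - m * (f 1 - f 0) := by
    have hS := sum_dg_sq_le h
    have hq := hf.excess_nonneg m
    -- The comparison divides by `m(m-1)`, so `m ≤ 1` is separate; there all excesses vanish.
    rcases Nat.lt_or_ge m 2 with hm | hm
    · have h0 : ∀ v ∈ S, f (dg G S v) - f 0 - dg G S v * (f 1 - f 0) = 0 ∧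
          (dg G S v : ℝ) * (dg G S v - 1) = 0 := fun v hv => by
        have hd : dg G S v ≤ 1 := (dg_le_of_degSum h hv).trans (by omega)
        rcases Nat.le_one_iff_eq_zero_or_eq_one.1 hd with e | e <;> simp [e]
      rw [Finset.sum_eq_zero fun v hv => (h0 v hv).1]
      rw [Finset.sum_eq_zero fun v hv => by rw [(h0 v hv).2]; simp] at hT
      linarith
    have hm2 : (2 : ℝ) ≤ m := by exact_mod_cast hm
    have hpos : (0 : ℝ) < m * (m - 1) := mul_pos (by linarith) (by linarith)
    refine le_of_mul_le_mul_right ?_ hpos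
    -- A vertex of degree `m` carries all the edges, so there are no triangles. Otherwise all
    -- degrees are below `m`, and `excess_lt` absorbs the triangle term bounded in `hT`.
    by_cases hc : ∃ v ∈ S, dg G S v = m
    · obtain ⟨v, hv, hvm⟩ := hc
      have hz : degSum G (S.erase v) = 0 := by
        have := degSum_erase G hv
        omega
      have hz' : ∀ y ∈ S.erase v, ∀ z ∈ S.erase v, adjInd G y z = 0 := fun y hy z hz2 =>
        adjInd_of_not_adj (not_adj_of_dg_zero (Finset.sum_eq_zero_iff.1 hz y hy) hz2)
      have hT0 : triW (adjInd G) S = 0 := by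
        rw [triW_erase (adjInd_self G) (adjInd_comm G) hv]
        have e1 : triW (adjInd G) (S.erase v) = 0 :=
          Finset.sum_eq_zero fun x hx => Finset.sum_eq_zero fun y hy =>
            Finset.sum_eq_zero fun z _ => by rw [hz' x hx y hy]; ring
        rw [e1, Finset.sum_eq_zero fun x hx => Finset.sum_eq_zero fun y hy => by
          rw [hz' x hx y hy]; ring]
        ring
      rw [hT0, mul_zero, zero_div, add_zero, Finset.sum_mul]
      refine (Finset.sum_le_sum fun v hv => hf.excess_le (dg_le_of_degSum h hv)).trans ?_
      rw [← Finset.sum_mul, mul_comm]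
      exact mul_le_mul_of_nonneg_left hS hq
    · push Not at hc
      refine (mul_le_mul_of_nonneg_right (add_le_add_right hT _) hpos.le).trans ?_
      rw [← Finset.sum_add_distrib, Finset.sum_mul]
      refine (Finset.sum_le_sum fun v hv => hf.excess_lt
        (lt_of_le_of_ne (dg_le_of_degSum h hv) (hc v hv))).trans ?_
      rw [← Finset.sum_mul, mul_comm]
      exact mul_le_mul_of_nonneg_left hS hq
  unfold wt
  rw [hsplit]
  linarith

end Star

/-! ### The weight of the lexicographic graph -/

section LexWeight

/-- The weight of the lexicographic graph on `n` vertices in which `a` vertices are adjacent to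
all others, and one further vertex is adjacent to `s` others beyond these. -/
noncomputable def lexWt (f : ℕ → ℝ) (θ : ℝ) (n a s : ℕ) : ℝ :=
  a * f (n - 1) + f (a + s) + s * f (a + 1) + ((n : ℝ) - 1 - a - s) * f a
    + θ * ((a : ℝ) * (a - 1) * (a - 2) / 6 + (a : ℝ) * (a - 1) / 2 * (n - a) + s * a)

variable {f : ℕ → ℝ} {θ : ℝ}

lemma lexWt_succ {n : ℕ} (hn : 1 ≤ n) (a s : ℕ) :
    lexWt f θ (n + 1) (a + 1) s = f n + lexWt (fun x => f (x + 1)) θ n a s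
      + θ * (a * n - (a : ℝ) * (a + 1) / 2 + s) := by
  unfold lexWt
  simp only [Nat.sub_add_cancel hn]
  rw [Nat.add_sub_cancel, show a + 1 + s = a + s + 1 by ring]
  push_cast
  ring

/-- When the partial vertex reaches all others, the graph has two descriptions. -/
lemma lexWt_full (a s : ℕ) :
    lexWt f θ (a + 1 + s) a s = lexWt f θ (a + 1 + s) (a + 1) 0 := by
  unfold lexWt
  rw [show a + 1 + s - 1 = a + s by omega]
  push_cast
  ring

lemma sum_range_sub_cast (a b : ℕ) :
    ∑ i ∈ range a, ((b : ℝ) - i) = a * b - a * (a - 1) / 2 := by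
  induction a with
  | zero => simp
  | succ a ih => rw [Finset.sum_range_succ, ih]; push_cast; ring

lemma telescope (f : ℕ → ℝ) (b k : ℕ) :
    ∑ i ∈ range k, (f (b + i + 1) - f (b + i)) = f (b + k) - f b := by
  have := Finset.sum_range_sub (fun i => f (b + i)) k
  simpa [add_assoc] using this

/-- The last vertex meets only the `a` full ones. Its `a` edges are moved to the partial vertex,
which has room for them. -/
lemma lexWt_step_same (hf : ThirdConvex θ f) (a s c : ℕ) :
    f 0 + lexWt f θ (2 * a + s + 1 + c) a (s + a) ≤ lexWt f θ (2 * a + s + 2 + c) a s := by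
  -- One inequality per moved edge: gain at the centre, loss at the abandoned vertex, gain at the
  -- new leaf, and a share of the new triangles, against the loss at a full vertex.
  have key : ∀ i ∈ range a, (f (a + s + i + 1) - f (a + s + i)) - (f (0 + i + 1) - f (0 + i))
      + (f (a + 1) - f a) + θ * ((a : ℝ) - i)
      ≤ f (2 * a + s + c + 1) - f (2 * a + s + c) := by
    intro i hi
    obtain ⟨k, rfl⟩ : ∃ k, a = i + k + 1 := ⟨a - i - 1, by
      have := Finset.mem_range.1 hi; omega⟩
    have h1 := hf.gap i (i + k + 1 + s) (k + 1)
    have h2 := hf.monotone_diff (show i + (i + k + 1 + s) + (k + 1) ≤ 2 * (i + k + 1) + s + c by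
      omega)
    simp only at h2
    have h3 : θ * ((i + k + 1 : ℕ) - i : ℝ) ≤ θ * ((k + 1 : ℕ) : ℝ) * ((i + k + 1 + s : ℕ) : ℝ) := by
      rw [mul_assoc]
      refine mul_le_mul_of_nonneg_left ?_ hf.nonneg
      push_cast
      have : (0 : ℝ) ≤ (k + 1) * (i + k + s) := by positivity
      linarith
    rw [show i + (k + 1) = i + k + 1 by ring, show i + (i + k + 1 + s) = i + k + 1 + s + i by ring]
      at h1
    rw [show i + (i + k + 1 + s) = i + k + 1 + s + i by ring] at h2
    rw [zero_add]
    linarith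
  have hsum := Finset.sum_le_sum key
  simp only [Finset.sum_add_distrib, Finset.sum_sub_distrib (f := fun i =>
    f (a + s + i + 1) - f (a + s + i)), ← Finset.mul_sum, sum_range_sub_cast, telescope,
    Finset.sum_const, Finset.card_range, nsmul_eq_mul] at hsum
  rw [zero_add] at hsum
  unfold lexWt
  rw [show 2 * a + s + 1 + c - 1 = 2 * a + s + c by omega,
    show 2 * a + s + 2 + c - 1 = 2 * a + s + c + 1 by omega,
    show a + (s + a) = a + s + a by ring]
  push_cast
  linarith

/-- Here the partial vertex has room for only `u` of the `u + k` moved edges (`key1`) and becomes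
full; the other `k` start the next vertex (`key2`). -/
lemma lexWt_step_succ (hf : ThirdConvex θ f) (u k c : ℕ) :
    f 0 + lexWt f θ (2 * (u + k) + 3 + c) (u + k + 1) k
      ≤ lexWt f θ (2 * (u + k) + 4 + c) (u + k) (k + 2 + c) := by
  have key1 : ∀ i ∈ range u, (f (u + 2 * k + 2 + c + i + 1) - f (u + 2 * k + 2 + c + i))
      - (f (k + i + 1) - f (k + i)) + (f (u + k + 1) - f (u + k)) + θ * ((u : ℝ) - i)
      ≤ f (2 * (u + k) + 3 + c) - f (2 * (u + k) + 2 + c) := by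
    intro i hi
    obtain ⟨p, rfl⟩ : ∃ p, u = i + p + 1 := ⟨u - i - 1, by
      have := Finset.mem_range.1 hi; omega⟩
    have h1 := hf.gap (k + i) (i + p + k + 3 + c) (p + 1)
    have h3 : θ * ((i + p + 1 : ℕ) - i : ℝ)
        ≤ θ * ((p + 1 : ℕ) : ℝ) * ((i + p + k + 3 + c : ℕ) : ℝ) := by
      rw [mul_assoc]
      refine mul_le_mul_of_nonneg_left ?_ hf.nonneg
      push_cast
      have : (0 : ℝ) ≤ (p + 1) * (i + p + k + 2 + c) := by positivity
      linarith
    rw [show k + i + (p + 1) = i + p + 1 + k by ring,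
      show k + i + (i + p + k + 3 + c) + (p + 1) = 2 * (i + p + 1 + k) + 2 + c by ring,
      show k + i + (i + p + k + 3 + c) = i + p + 1 + 2 * k + 2 + c + i by ring,
      show 2 * (i + p + 1 + k) + 2 + c + 1 = 2 * (i + p + 1 + k) + 3 + c by ring] at h1
    linarith
  have key2 : ∀ i ∈ range k, (f (u + k + 1 + i + 1) - f (u + k + 1 + i))
      - (f (0 + i + 1) - f (0 + i)) + (f (u + k + 2) - f (u + k + 1))
      + θ * (((u + k + 1 : ℕ) : ℝ) - i)
      ≤ f (2 * (u + k) + 3 + c) - f (2 * (u + k) + 2 + c) := by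
    intro i hi
    obtain ⟨p, rfl⟩ : ∃ p, k = i + p + 1 := ⟨k - i - 1, by
      have := Finset.mem_range.1 hi; omega⟩
    have h1 := hf.gap i (u + p + 2) (u + (i + p + 1) + 1)
    have h2 := hf.monotone_diff (show i + (u + p + 2) + (u + (i + p + 1) + 1)
      ≤ 2 * (u + (i + p + 1)) + 2 + c by omega)
    simp only at h2
    have h3 : θ * (((u + (i + p + 1) + 1 : ℕ) : ℝ) - i)
        ≤ θ * ((u + (i + p + 1) + 1 : ℕ) : ℝ) * ((u + p + 2 : ℕ) : ℝ) := by
      rw [mul_assoc]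
      refine mul_le_mul_of_nonneg_left ?_ hf.nonneg
      push_cast
      have : (0 : ℝ) ≤ (u + p + 2) * (u + i + p + 1) := by positivity
      linarith
    rw [show i + (u + (i + p + 1) + 1) = u + (i + p + 1) + 1 + i by ring,
      show i + (u + p + 2) = u + (i + p + 1) + 1 by ring] at h1
    rw [show i + (u + p + 2) = u + (i + p + 1) + 1 by ring,
      show 2 * (u + (i + p + 1)) + 2 + c + 1 = 2 * (u + (i + p + 1)) + 3 + c by ring] at h2
    rw [zero_add]
    rw [show u + (i + p + 1) + 1 + 1 = u + (i + p + 1) + 2 by ring] at h1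
    linarith
  have s1 := Finset.sum_le_sum key1
  have s2 := Finset.sum_le_sum key2
  simp only [Finset.sum_add_distrib, Finset.sum_sub_distrib (f := fun i =>
    f (u + 2 * k + 2 + c + i + 1) - f (u + 2 * k + 2 + c + i)), ← Finset.mul_sum,
    sum_range_sub_cast, telescope, Finset.sum_const, Finset.card_range, nsmul_eq_mul] at s1
  simp only [Finset.sum_add_distrib, Finset.sum_sub_distrib (f := fun i =>
    f (u + k + 1 + i + 1) - f (u + k + 1 + i)), ← Finset.mul_sum,
    sum_range_sub_cast, telescope, Finset.sum_const, Finset.card_range, nsmul_eq_mul] at s2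
  rw [zero_add] at s2
  unfold lexWt
  rw [show 2 * (u + k) + 3 + c - 1 = 2 * (u + k) + 2 + c by omega,
    show 2 * (u + k) + 4 + c - 1 = 2 * (u + k) + 3 + c by omega,
    show u + k + (k + 2 + c) = u + 2 * k + 2 + c by ring,
    show u + k + 1 + 1 = u + k + 2 by ring]
  rw [show u + 2 * k + 2 + c + u = 2 * (u + k) + 2 + c by ring, add_comm k u] at s1
  push_cast at *
  linarith

/-- The weight of the lexicographic graph does not decrease when an isolated vertex is
added. -/
lemma exists_lexWt_step (hf : ThirdConvex θ f) {n a s : ℕ} (h1 : a + s + 1 ≤ n)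
    (h2 : 2 * a + 4 ≤ n + 1) : ∃ a' s', a' + s' + 1 ≤ n ∧
      2 * a' * n + 2 * s' + a * (a + 1) = 2 * a * (n + 1) + 2 * s + a' * (a' + 1) ∧
      f 0 + lexWt f θ n a' s' ≤ lexWt f θ (n + 1) a s := by
  rcases Nat.lt_or_ge n (2 * a + s + 1) with h | h
  -- `u` is the room left at the partial vertex, `k` the overflow, and `c` the slack in `2 * a + 4 ≤
  -- n + 1`.
  · obtain ⟨u, hu⟩ : ∃ u, n = 1 + a + s + u := ⟨n - 1 - a - s, by omega⟩
    obtain ⟨k, rfl⟩ : ∃ k, a = u + k := ⟨a - u, by omega⟩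
    obtain ⟨c, rfl⟩ : ∃ c, s = k + 2 + c := ⟨s - k - 2, by omega⟩
    obtain rfl : n = 2 * (u + k) + 3 + c := by omega
    refine ⟨u + k + 1, k, by omega, by ring, ?_⟩
    have := lexWt_step_succ hf u k c
    rwa [show 2 * (u + k) + 4 + c = 2 * (u + k) + 3 + c + 1 by ring] at this
  · obtain ⟨c, rfl⟩ : ∃ c, n = 2 * a + s + 1 + c := ⟨n - (2 * a + s + 1), by omega⟩
    refine ⟨a, s + a, by omega, by ring, ?_⟩
    have := lexWt_step_same hf a s c
    rwa [show 2 * a + s + 2 + c = 2 * a + s + 1 + c + 1 by ring] at this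

end LexWeight

/-! ### Peeling isolated and full vertices -/

section Chain

variable {V : Type*} [DecidableEq V]

lemma exists_adj_of_degSum_pos {G : SimpleGraph V} {S : Finset V} (h : 0 < degSum G S) :
    ∃ x ∈ S, ∃ y ∈ S, G.Adj x y := by
  by_contra hn
  push Not at hn
  apply h.ne'
  refine Finset.sum_eq_zero fun x hx => ?_
  classical
  unfold dg
  rw [Finset.card_eq_zero, Finset.filter_eq_empty_iff]
  exact fun y hy => hn x hx y hy

lemma lexWt_zero (f : ℕ → ℝ) (θ : ℝ) (n s : ℕ) :
    lexWt f θ n 0 s = f s + s * f 1 + (n - 1 - s) * f 0 := by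
  unfold lexWt
  simp

/-- If `2a + 3 ≥ n`, the `a` full vertices alone give `4D ≥ 3n² - 8n - 3`. As `n ≥ K - i + 2`, this
exceeds the bound on `4D`, which is at most `3(K-i)² + 4(K-i) - 8`. -/
lemma two_mul_add_four_le {D a s n i K : ℕ} (hD : D + a * (a + 1) = 2 * a * n + 2 * s)
    (ha : a + 1 ≤ n) (hK : 4 * D + 8 * i * K + 4 * i + 8 ≤ 3 * K ^ 2 + 4 * K + 4 * i ^ 2)
    (hi : i ≤ K) (hn : K + 2 ≤ n + i) : 2 * a + 4 ≤ n := by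
  by_contra hcon
  obtain ⟨z, rfl⟩ : ∃ z, K = i + z := ⟨K - i, by omega⟩
  obtain ⟨e, rfl⟩ : ∃ e, n = z + 2 + e := ⟨n - (z + 2), by omega⟩
  obtain ⟨w, hw⟩ : ∃ w, 2 * a + 3 = z + 2 + e + w := ⟨2 * a + 3 - (z + 2 + e), by omega⟩
  obtain ⟨b, hb⟩ : ∃ b, z + 2 + e = a + 1 + b := ⟨z + 2 + e - (a + 1), by omega⟩
  zify at *
  -- With `n = z + 2 + e` this product expands to `8an - 4a(a+1) - (3n² - 8n - 3)`.
  have p1 : (0 : ℤ) ≤ w * (2 * b + (z + 2 + e) + 3) := by positivity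
  rw [show (w : ℤ) = 2 * a + 3 - (z + 2 + e) by linarith,
    show (b : ℤ) = z + 2 + e - (a + 1) by linarith] at p1
  have p2 : (0 : ℤ) ≤ e * (3 * e + 6 * z + 4) := by positivity
  have p3 : (0 : ℤ) ≤ i ^ 2 + 2 * i * z := by positivity
  have p4 : (0 : ℤ) ≤ s := by positivity
  linarith

/-- If the neighbourhoods are nested and every edge has an endpoint of large degree, then the
weight is at most that of the lexicographic graph. -/
lemma wt_le_lexWt_of_cover {θ : ℝ} {G : SimpleGraph V} {K : ℕ} (n : ℕ) :
    ∀ {f : ℕ → ℝ} {S : Finset V} {i a s : ℕ}, ThirdConvex θ f → S.card = n → a + s + 1 ≤ n →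
      degSum G S + a * (a + 1) = 2 * a * n + 2 * s → Nested G S →
      (∀ x ∈ S, ∀ y ∈ S, G.Adj x y → K ≤ dg G S x + i ∨ K ≤ dg G S y + i) →
      4 * degSum G S + 8 * i * K + 4 * i + 8 ≤ 3 * K ^ 2 + 4 * K + 4 * i ^ 2 → i ≤ K →
      wt f θ G S ≤ lexWt f θ n a s := by
  induction n with
  | zero => intro f S i a s _ _ h; omega
  | succ n ih =>
    intro f S i a s hf hcard has hD hnest hcov hK hiK
    rcases Nat.eq_zero_or_pos a with rfl | ha
    · rw [lexWt_zero, ← hcard]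
      exact wt_le_star hf (by omega)
    have hDpos : 0 < degSum G S := by
      by_contra h0
      have h1 : degSum G S = 0 := by omega
      rw [h1] at hD
      nlinarith
    obtain ⟨x, hx, y, hy, hxy, hxK⟩ : ∃ x ∈ S, ∃ y ∈ S, G.Adj x y ∧ K ≤ dg G S x + i := by
      obtain ⟨x, hx, y, hy, hxy⟩ := exists_adj_of_degSum_pos hDpos
      rcases hcov x hx y hy hxy with h | h
      · exact ⟨x, hx, y, hy, hxy, h⟩
      · exact ⟨y, hy, x, hx, hxy.symm, h⟩
    obtain ⟨v, hv, hv0 | hvf⟩ := hnest.exists_isolated_or_full ⟨x, hx⟩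
    · have hcard' : (S.erase v).card = n := by rw [Finset.card_erase_of_mem hv, hcard]; omega
      have hnadj : ∀ z ∈ S, ¬ G.Adj z v := fun z hz h => not_adj_of_dg_zero hv0 hz h.symm
      have hdg : ∀ z ∈ S, dg G S z = dg G (S.erase v) z := fun z hz =>
        dg_erase_of_not_adj hv (hnadj z hz)
      have hDv := degSum_erase G hv
      rw [hv0, mul_zero, add_zero] at hDv
      have hxv : x ≠ v := fun e => hnadj y hy (e ▸ hxy.symm)
      have hn : K + 2 ≤ n + 1 + i := by
        have h1 := dg_lt_card G (S := S.erase v) (Finset.mem_erase.2 ⟨hxv, hx⟩)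
        rw [← hdg x hx, hcard'] at h1
        omega
      have hstep : ∀ a s, a + s + 1 ≤ n → degSum G S + a * (a + 1) = 2 * a * (n + 1) + 2 * s →
          wt f θ G S ≤ lexWt f θ (n + 1) a s := by
        intro a s h1 h2
        have h3 := two_mul_add_four_le h2 (by omega) hK hiK hn
        obtain ⟨a', s', h4, h5, h6⟩ := exists_lexWt_step hf h1 h3
        rw [wt_erase_isolated hv hv0]
        have := ih (i := i) hf hcard' h4 (by rw [← hDv]; omega) (hnest.mono (Finset.erase_subset v S))
          (fun p hp q hq hpq => by
            have hp' := Finset.mem_of_mem_erase hp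
            have hq' := Finset.mem_of_mem_erase hq
            rw [← hdg p hp', ← hdg q hq']
            exact hcov p hp' q hq' hpq) (by rwa [← hDv]) hiK
        linarith
      -- If the partial vertex already meets everything, the description `(a + 1, 0)` is used, since
      -- the step needs `a + s + 1 ≤ n`.
      rcases Nat.lt_or_ge n (a + s + 1) with h | h
      · have h3 := two_mul_add_four_le hD (by omega) hK hiK hn
        obtain rfl : n = a + s := by omega
        have hfull := lexWt_full (f := f) (θ := θ) a s
        rw [show a + 1 + s = a + s + 1 by ring] at hfull
        rw [hfull]
        refine hstep (a + 1) 0 (by omega) ?_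
        linarith
      · exact hstep a s h hD
    · have hvn : dg G S v = n := by omega
      have hcard' : (S.erase v).card = n := by rw [Finset.card_erase_of_mem hv, hcard]; omega
      obtain ⟨a, rfl⟩ : ∃ b, a = b + 1 := ⟨a - 1, by omega⟩
      have hDv := degSum_erase G hv
      rw [hvn] at hDv
      have hiK' : i < K := by
        rcases hiK.lt_or_eq with h | rfl
        · exact h
        · nlinarith
      have hxn : K ≤ n + i := by
        have := dg_lt_card G hx
        omega
      have hD' : degSum G (S.erase v) + a * (a + 1) = 2 * a * n + 2 * s := by nlinarith
      -- The degree sum falls by `2n` with `n ≥ K - i`, exactly enough for the numerical condition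
      -- to survive the passage from `i` to `i + 1`. Degrees drop by one, so degree plus `i` is
      -- unchanged.
      have := ih (f := fun x => f (x + 1)) (i := i + 1) hf.shift hcard' (by omega) hD'
        (hnest.mono (Finset.erase_subset v S))
        (fun p hp q hq hpq => by
          have hp' := Finset.mem_of_mem_erase hp
          have hq' := Finset.mem_of_mem_erase hq
          have h1 := dg_erase_of_adj hv
            (adj_of_dg_full hv hvf hp' (Finset.ne_of_mem_erase hp)).symm
          have h2 := dg_erase_of_adj hv
            (adj_of_dg_full hv hvf hq' (Finset.ne_of_mem_erase hq)).symm
          have := hcov p hp' q hq' hpq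
          omega) (by nlinarith) hiK'
      rw [wt_erase_full hv hvf, lexWt_succ (by omega), hvn]
      have hD'' : (degSum G (S.erase v) : ℝ) + a * (a + 1) = 2 * a * n + 2 * s := by
        exact_mod_cast hD'
      have e : θ * (degSum G (S.erase v) : ℝ) / 2
          = θ * (a * n - (a : ℝ) * (a + 1) / 2 + s) := by
        rw [← eq_sub_iff_add_eq] at hD''
        rw [hD'']; ring
      linarith

end Chain

/-! ### Binomial coefficients as weight functions -/

section Binomial

/-- The binomial coefficient as a function of the degree, shifted by `j`. -/
noncomputable def chooseFn (t j x : ℕ) : ℝ := ((x + j).choose t : ℝ)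

lemma chooseFn_shift (t j : ℕ) : (fun x => chooseFn t j (x + 1)) = chooseFn t (j + 1) := by
  funext x
  simp only [chooseFn, show x + 1 + j = x + (j + 1) by ring]

lemma chooseFn_diff (r j x : ℕ) :
    chooseFn (r + 1) j (x + 1) - chooseFn (r + 1) j x = ((x + j).choose r : ℝ) := by
  simp only [chooseFn, show x + 1 + j = x + j + 1 by ring, Nat.choose_succ_succ]
  push_cast
  ring

/-- The weight of a triangle. -/
noncomputable def triCoeff (t : ℕ) : ℝ := if t = 3 then 1 else 0

lemma triCoeff_nonneg (t : ℕ) : 0 ≤ triCoeff t := by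
  unfold triCoeff; split_ifs <;> norm_num

/-- The third difference of `C(x, t)` is `C(x, t - 3)` for `t ≥ 3` and zero for `t = 2`. At `t = 3`
it equals 1, the weight of a triangle. -/
lemma thirdConvex_chooseFn (r j : ℕ) (hr : 1 ≤ r) :
    ThirdConvex (triCoeff (r + 1)) (chooseFn (r + 1) j) := by
  have d0 := chooseFn_diff r j
  obtain ⟨q, rfl⟩ : ∃ q, r = q + 1 := ⟨r - 1, by omega⟩
  have d1 := chooseFn_diff q j
  refine ⟨triCoeff_nonneg _, fun x => ?_, fun x => ?_, fun x => ?_⟩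
  · have := d0 x
    have h : (0 : ℝ) ≤ ((x + j).choose (q + 1) : ℝ) := Nat.cast_nonneg _
    linarith
  · rw [d0 (x + 1), d0 x]
    exact_mod_cast Nat.choose_le_choose _ (by omega)
  · have e1 := d0 x
    have e2 := d0 (x + 1)
    have e3 := d0 (x + 2)
    have f1 := d1 x
    have f2 := d1 (x + 1)
    simp only [chooseFn] at f1 f2
    have hle : triCoeff (q + 1 + 1) ≤ ((x + 1 + j).choose q : ℝ) - ((x + j).choose q : ℝ) := by
      rcases Nat.eq_zero_or_pos q with rfl | hq
      · simp [triCoeff]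
      · obtain ⟨p, rfl⟩ : ∃ p, q = p + 1 := ⟨q - 1, by omega⟩
        have := chooseFn_diff p j x
        simp only [chooseFn] at this
        rw [this]
        unfold triCoeff
        split_ifs with h
        · obtain rfl : p = 0 := by omega
          simp
        · positivity
    rw [show x + 1 + 1 = x + 2 by ring] at *
    rw [show x + 2 + 1 = x + 3 by ring] at *
    linarith

end Binomial

/-! ### The main induction -/

section Core

variable {V : Type*} [DecidableEq V]

/-- A bound on the weight when all degrees are small. -/
lemma wt_le_lexWt_of_rate {f : ℕ → ℝ} {θ ρ : ℝ} (hf : ThirdConvex θ f) {G : SimpleGraph V}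
    {S : Finset V} {a s : ℕ} (ha : 1 ≤ a) (has : a + s + 1 ≤ S.card)
    (hD : degSum G S + a * (a + 1) = 2 * a * S.card + 2 * s) (hρ : 0 ≤ ρ)
    (hX : 4 * ρ * ((S.card : ℝ) - 1) ≤ f (S.card - 1) - f 0)
    (hd : ∀ x ∈ S, f (dg G S x) - f 0 + θ * (dg G S x * (dg G S x - 1 : ℝ)) / 6
      ≤ ρ * dg G S x) :
    wt f θ G S ≤ lexWt f θ S.card a s := by
  have hup : wt f θ G S ≤ S.card * f 0 + ρ * degSum G S := by
    have h1 := Finset.sum_le_sum hd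
    rw [← Finset.mul_sum, ← degSum_cast, Finset.sum_add_distrib, Finset.sum_sub_distrib,
      Finset.sum_const, nsmul_eq_mul, ← Finset.sum_div, ← Finset.mul_sum] at h1
    have h2 := mul_le_mul_of_nonneg_left (triW_le G S) hf.nonneg
    unfold wt
    linarith
  have hD' : (degSum G S : ℝ) + a * (a + 1) = 2 * a * S.card + 2 * s := by exact_mod_cast hD
  have has' : (a : ℝ) + s + 1 ≤ S.card := by exact_mod_cast has
  have ha' : (1 : ℝ) ≤ a := by exact_mod_cast ha
  -- The edges meet `a + 1` vertices of degree at most `n - 1`, so the degree sum is at most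
  -- `2(a+1)(n-1) ≤ 4a(n-1)`; this is the source of the 4 in the rate condition.
  have hD4 : (degSum G S : ℝ) ≤ a * (4 * ((S.card : ℝ) - 1)) := by
    have hs : (0 : ℝ) ≤ s := Nat.cast_nonneg s
    nlinarith
  have h3 := mul_le_mul_of_nonneg_left hD4 hρ
  have h4 := mul_le_mul_of_nonneg_left hX (show (0 : ℝ) ≤ a by linarith)
  have m1 := hf.monotone (Nat.zero_le (a + s))
  have m2 := mul_le_mul_of_nonneg_left (hf.monotone (Nat.zero_le (a + 1))) (Nat.cast_nonneg (α := ℝ) s)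
  have m3 := mul_le_mul_of_nonneg_left (hf.monotone (Nat.zero_le a))
    (show (0 : ℝ) ≤ (S.card : ℝ) - 1 - a - s by linarith)
  have hθ : 0 ≤ θ * ((a : ℝ) * (a - 1) * (a - 2) / 6
      + (a : ℝ) * (a - 1) / 2 * (S.card - a) + s * a) := by
    refine mul_nonneg hf.nonneg ?_
    have p1 : (0 : ℝ) ≤ (a : ℝ) * (a - 1) * (a - 2) := by
      rcases Nat.eq_or_lt_of_le ha with e | h
      · rw [← e]; norm_num
      · have : (2 : ℝ) ≤ a := by exact_mod_cast h
        exact mul_nonneg (mul_nonneg (by linarith) (by linarith)) (by linarith)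
    have p2 : (0 : ℝ) ≤ (a : ℝ) * (a - 1) / 2 * (S.card - a) := by
      have hs : (0 : ℝ) ≤ s := Nat.cast_nonneg s
      exact mul_nonneg (div_nonneg (mul_nonneg (by linarith) (by linarith)) (by norm_num))
        (by linarith)
    have p3 : (0 : ℝ) ≤ (s : ℝ) * a := by positivity
    linarith
  unfold lexWt
  linarith

/-- The degree sum is at most that of a graph with `ℓ - j` full vertices on `N - j`, that is
`(ℓ-j)(2N-ℓ-j-1)`. For `j = 0` the claim is then the hypothesis on `K`; for `j > 0` it follows from
`K + 1 ≤ N`. -/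
lemma initial_bound {N ℓ K D n j b s : ℕ} (hK : 8 * ℓ * N + 8 ≤ 3 * K ^ 2 + 4 * K + 4 * ℓ ^ 2 + 4 * ℓ)
    (hKN : K + 1 ≤ N) (hℓ : ℓ ≤ N) (hn : n + j = N) (hb : b + s + 1 ≤ n) (hbj : b + j + 1 ≤ ℓ)
    (hD : D + b * (b + 1) = 2 * b * n + 2 * s) :
    4 * D + 8 * j * K + 4 * j + 8 ≤ 3 * K ^ 2 + 4 * K + 4 * j ^ 2 := by
  obtain ⟨c, rfl⟩ : ∃ c, n = b + s + 1 + c := ⟨n - (b + s + 1), by omega⟩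
  obtain ⟨e, rfl⟩ : ∃ e, ℓ = b + j + 1 + e := ⟨ℓ - (b + j + 1), by omega⟩
  subst hn
  obtain ⟨g, hg⟩ : ∃ g, s + c = e + g := ⟨s + c - e, by omega⟩
  obtain ⟨k, hk⟩ : ∃ k, b + s + 1 + c + j = K + 1 + k := ⟨b + s + 1 + c + j - (K + 1), by omega⟩
  zify at *
  have p1 : (0 : ℤ) ≤ e * g := by positivity
  rw [show (g : ℤ) = s + c - e by linarith] at p1
  have p2 : (0 : ℤ) ≤ j * k := by positivity
  have p3 : (j : ℤ) * (b + s + 1 + c + j) = j * (K + 1 + k) := by rw [hk]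
  have p4 : (e : ℤ) ≤ e ^ 2 := by exact_mod_cast Nat.le_self_pow two_ne_zero e
  have p5 : (0 : ℤ) ≤ c := by positivity
  linarith

/-- Here `j` counts the full vertices already deleted, so true degrees are `d + j`. The bound on `Δ`
in `hrate` is exactly the negation of the gain condition in `IsOpt.not_small_edge`. -/
theorem wt_le_lexWt [Finite V] {r N ℓ K : ℕ} (hr : 1 ≤ r)
    (hK : 8 * ℓ * N + 8 ≤ 3 * K ^ 2 + 4 * K + 4 * ℓ ^ 2 + 4 * ℓ)
    (hKN : K + 1 ≤ N) (hℓN : ℓ ≤ N) (hℓK : ℓ ≤ K)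
    (hrate : ∀ j Δ : ℕ, j + 2 ≤ ℓ →
      (Δ.choose r : ℝ) ≤ 2 * ((K - 1).choose r : ℝ) + triCoeff (r + 1) * ((K - 1 : ℕ) : ℝ) →
      ∃ ρ : ℝ, 0 ≤ ρ ∧
        4 * ρ * ((N : ℝ) - 1 - j) ≤ ((N - 1).choose (r + 1) : ℝ) - (j.choose (r + 1) : ℝ) ∧
        ∀ d : ℕ, d + j ≤ Δ → ((d + j).choose (r + 1) : ℝ) - (j.choose (r + 1) : ℝ)
          + triCoeff (r + 1) * (d * (d - 1 : ℝ)) / 6 ≤ ρ * d) (a : ℕ) :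
    ∀ {G : SimpleGraph V} {S : Finset V} {j s : ℕ}, S.card + j = N → a + s + 1 ≤ S.card →
      a + j + 1 ≤ ℓ → degSum G S + a * (a + 1) = 2 * a * S.card + 2 * s →
      wt (chooseFn (r + 1) j) (triCoeff (r + 1)) G S
        ≤ lexWt (chooseFn (r + 1) j) (triCoeff (r + 1)) S.card a s := by
  induction a with
  | zero =>
    intro G S j s _ _ _ hD
    rw [lexWt_zero]
    exact wt_le_star (thirdConvex_chooseFn r j hr) (by omega)
  | succ a ih =>
    intro G S j s hN has haj hD
    have hf := thirdConvex_chooseFn r j hr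
    obtain ⟨H, hHD, hGH, hopt⟩ := exists_isOpt (chooseFn (r + 1) j) (triCoeff (r + 1)) G S
    refine hGH.trans ?_
    rw [← hHD] at hD
    have hnest := hopt.nested hf
    by_cases hfull : ∃ v ∈ S, dg H S v + 1 = S.card
    · obtain ⟨v, hv, hvf⟩ := hfull
      have hcard' : (S.erase v).card + 1 = S.card := Finset.card_erase_add_one hv
      have hDv := degSum_erase H hv
      obtain ⟨n, hn⟩ : ∃ n, S.card = n + 1 := ⟨S.card - 1, by omega⟩
      have hvn : dg H S v = n := by omega
      have hcn : (S.erase v).card = n := by omega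
      rw [hn, hDv, hvn] at hD
      have hD' : degSum H (S.erase v) + a * (a + 1) = 2 * a * n + 2 * s := by nlinarith
      have := ih (G := H) (S := S.erase v) (j := j + 1) (s := s) (by omega) (by omega) (by omega)
        (by rw [hcn]; exact hD')
      rw [wt_erase_full hv hvf, hn, lexWt_succ (by omega), hvn, chooseFn_shift]
      rw [hcn] at this
      have hD'' : (degSum H (S.erase v) : ℝ) + a * (a + 1) = 2 * a * n + 2 * s := by
        exact_mod_cast hD'
      have e : triCoeff (r + 1) * (degSum H (S.erase v) : ℝ) / 2
          = triCoeff (r + 1) * (a * n - (a : ℝ) * (a + 1) / 2 + s) := by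
        rw [← eq_sub_iff_add_eq] at hD''
        rw [hD'']; ring
      linarith
    · push Not at hfull
      have hSne : S.Nonempty := Finset.card_pos.1 (by omega)
      obtain ⟨v, hv, hmax⟩ := Finset.exists_max_image S (dg H S) hSne
      obtain ⟨w, hw, hwv, hvw⟩ : ∃ w ∈ S, w ≠ v ∧ ¬ H.Adj v w := by
        by_contra hn
        push Not at hn
        apply hfull v hv
        classical
        rw [dg_erase_self hv, ← Finset.card_erase_add_one hv]
        unfold dg
        rw [Finset.filter_true_of_mem]
        exact fun w hw => hn w (Finset.mem_of_mem_erase hw) (Finset.ne_of_mem_erase hw)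
      have hw0 := hnest.isolated hv hmax hw hwv hvw
      -- Small maximum degree: the linear bound. Large: the edge exchange forces a cover by vertices
      -- of degree at least `K - j`.
      by_cases hbig : ((dg H S v + j).choose r : ℝ)
          ≤ 2 * ((K - 1).choose r : ℝ) + triCoeff (r + 1) * ((K - 1 : ℕ) : ℝ)
      · obtain ⟨ρ, hρ0, hρX, hρd⟩ := hrate j _ (by omega) hbig
        refine wt_le_lexWt_of_rate hf (by omega) has hD hρ0 ?_ fun x hx => ?_
        · have hSN : (S.card : ℝ) = N - j := by
            rw [← hN]; push_cast; ring
          simp only [chooseFn, show S.card - 1 + j = N - 1 by omega, zero_add]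
          rw [hSN, show (N : ℝ) - j - 1 = N - 1 - j by ring]
          exact hρX
        · have := hρd (dg H S x) (Nat.add_le_add_right (hmax x hx) j)
          simpa only [chooseFn, zero_add] using this
      · push Not at hbig
        have hθK : 0 ≤ triCoeff (r + 1) * ((K - 1 : ℕ) : ℝ) :=
          mul_nonneg (triCoeff_nonneg _) (Nat.cast_nonneg _)
        have hΔK : K ≤ dg H S v + j := by
          by_contra hlt
          have h1 : ((dg H S v + j).choose r : ℝ) ≤ ((K - 1).choose r : ℝ) := by
            exact_mod_cast Nat.choose_le_choose r (by omega)
          have h2 : (0 : ℝ) ≤ ((K - 1).choose r : ℝ) := Nat.cast_nonneg _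
          linarith
        refine wt_le_lexWt_of_cover S.card (K := K) (i := j) hf rfl has hD hnest
          (fun x hx y hy hxy => ?_) ?_ (by omega)
        · by_contra hcon
          push Not at hcon
          have hxv : x ≠ v := fun e => by rw [e] at hcon; omega
          have hyv : y ≠ v := fun e => by rw [e] at hcon; omega
          -- An end of degree below `K - j` has degree at most `k + 1` for `k = K - 1 - j`, and the
          -- first difference of the shifted binomial at `k` is `C(K-1, r)`.
          refine hopt.not_small_edge hf hv hw hx hy hwv hw0 hxy hxv hyv (k := K - 1 - j)
            (by omega) (by omega) ?_
          rw [chooseFn_diff, chooseFn_diff, show K - 1 - j + j = K - 1 by omega]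
          refine lt_of_le_of_lt ?_ hbig
          have : triCoeff (r + 1) * ((K - 1 - j : ℕ) : ℝ)
              ≤ triCoeff (r + 1) * ((K - 1 : ℕ) : ℝ) :=
            mul_le_mul_of_nonneg_left (by exact_mod_cast Nat.sub_le _ _) (triCoeff_nonneg _)
          linarith
        · exact initial_bound hK hKN hℓN hN has haj hD

end Core

/-! ### Chord slopes and ratios of binomial coefficients -/

lemma ThirdConvex.chord {θ : ℝ} {f : ℕ → ℝ} (hf : ThirdConvex θ f) {d x : ℕ} (h : d ≤ x) :
    (f d - f 0) * x ≤ d * (f x - f 0) := by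
  have h1 : ∀ x : ℕ, (x + 1) * (f x - f 0) ≤ x * (f (x + 1) - f 0) := by
    intro x
    induction x with
    | zero => simp
    | succ x ih =>
      have := mul_le_mul_of_nonneg_left (hf.convex x) (show (0 : ℝ) ≤ x + 1 by positivity)
      push_cast
      rw [show x + 1 + 1 = x + 2 by ring]
      linarith
  rcases Nat.eq_zero_or_pos d with rfl | hd
  · simp
  induction x, h using Nat.le_induction with
  | base => linarith
  | succ x hx ih =>
    have hx0 : (0 : ℝ) < x := by exact_mod_cast (by omega : 0 < x)
    refine le_of_mul_le_mul_right ?_ hx0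
    have h2 := mul_le_mul_of_nonneg_left (h1 x) (Nat.cast_nonneg (α := ℝ) d)
    have h3 := mul_le_mul_of_nonneg_left ih (show (0 : ℝ) ≤ x + 1 by positivity)
    push_cast
    linarith

/-- `C(k, r) / k^r` increases with `k`, because each factor `(k - i)/k` does. -/
lemma choose_mul_pow_le (r : ℕ) {k n : ℕ} (h : k ≤ n) :
    k.choose r * n ^ r ≤ k ^ r * n.choose r := by
  induction r with
  | zero => simp
  | succ r ih =>
    have e1 := Nat.choose_succ_right_eq k r
    have e2 := Nat.choose_succ_right_eq n r
    have h1 : (k - r) * n ≤ k * (n - r) := by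
      rcases Nat.lt_or_ge k r with hk | hk
      · simp [Nat.sub_eq_zero_of_le hk.le]
      · rw [Nat.sub_mul, Nat.mul_sub]
        have : k * r ≤ r * n := by rw [mul_comm]; exact Nat.mul_le_mul_left r h
        omega
    refine Nat.le_of_mul_le_mul_right (c := r + 1) ?_ (Nat.succ_pos r)
    calc k.choose (r + 1) * n ^ (r + 1) * (r + 1)
        = (k.choose r * n ^ r) * ((k - r) * n) := by
          rw [pow_succ, mul_right_comm, e1]; ring
      _ ≤ (k ^ r * n.choose r) * (k * (n - r)) := Nat.mul_le_mul ih h1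
      _ = k ^ (r + 1) * n.choose (r + 1) * (r + 1) := by
          rw [mul_assoc (k ^ (r + 1)), e2]; ring

/-- The average of the binomial coefficients on an initial segment is at most that on a later
segment. -/
lemma choose_sub_mul_le (r : ℕ) (hr : 1 ≤ r) {j n : ℕ} (hj : j ≤ n) :
    ((n : ℝ) - j) * (n.choose (r + 1) : ℝ)
      ≤ ((n.choose (r + 1) : ℝ) - (j.choose (r + 1) : ℝ)) * n := by
  have := (thirdConvex_chooseFn r 0 hr).chord hj
  simp only [chooseFn, add_zero, Nat.choose_zero_succ, Nat.cast_zero, sub_zero] at this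
  linarith

lemma cast_choose_three (x : ℕ) : (x.choose 3 : ℝ) = x * (x - 1) * (x - 2) / 6 := by
  induction x with
  | zero => simp
  | succ x ih =>
    rw [Nat.choose_succ_succ' x 2]
    push_cast
    rw [ih, Nat.cast_choose_two]
    ring

/-! ### Linear bounds for small degrees -/

section Rates

variable {r N ℓ k : ℕ}

/-- With `M = N - 1` the claim is `8 (k/M)^r ≤ (2/3)^(r/2)`, squared: `(k/M)² ≤ 8ℓ/(3N)`, and the
lower bound on `N^r` supplies the rest. -/
lemma pow_estimate (hℓ : 1 ≤ ℓ) (hpow : 64 * 4 ^ r * ℓ ^ r ≤ N ^ r)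
    (hk : 3 * k ^ 2 * N ≤ 8 * ℓ * (N - 1) ^ 2) :
    64 * 3 ^ r * (k ^ r) ^ 2 ≤ 2 ^ r * ((N - 1) ^ r) ^ 2 := by
  have h1 := Nat.pow_le_pow_left hk r
  have hpos : 0 < 4 ^ r * ℓ ^ r := by positivity
  refine Nat.le_of_mul_le_mul_right ?_ hpos
  calc 64 * 3 ^ r * (k ^ r) ^ 2 * (4 ^ r * ℓ ^ r)
      = 3 ^ r * (k ^ r) ^ 2 * (64 * 4 ^ r * ℓ ^ r) := by ring
    _ ≤ 3 ^ r * (k ^ r) ^ 2 * N ^ r := Nat.mul_le_mul_left _ hpow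
    _ = (3 * k ^ 2 * N) ^ r := by simp only [mul_pow]; ring
    _ ≤ (8 * ℓ * (N - 1) ^ 2) ^ r := h1
    _ = 2 ^ r * ((N - 1) ^ r) ^ 2 * (4 ^ r * ℓ ^ r) := by
      rw [show 8 = 2 * 4 by norm_num]
      simp only [mul_pow]; ring

/-- The rate bound when triangles do not count. -/
lemma exists_rate (hr : 1 ≤ r) (hkN : k + 1 ≤ N) {j Δ : ℕ} (hjk : j < k)
    (hest : 64 * 3 ^ r * (k ^ r) ^ 2 ≤ 2 ^ r * ((N - 1) ^ r) ^ 2)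
    (hy : ∀ y, k ≤ y → 2 ^ r * y ^ 2 ≤ 3 ^ r * (y - j) ^ 2)
    (hΔ : Δ.choose r ≤ 2 * k.choose r) :
    ∃ ρ : ℝ, 0 ≤ ρ ∧
      4 * ρ * ((N : ℝ) - 1 - j) ≤ ((N - 1).choose (r + 1) : ℝ) - (j.choose (r + 1) : ℝ) ∧
      ∀ d : ℕ, d + j ≤ Δ → ((d + j).choose (r + 1) : ℝ) - (j.choose (r + 1) : ℝ) ≤ ρ * d := by
  -- `y = max Δ k`: the chord must cover all degrees up to `Δ`, while `hy` requires `k ≤ y`.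
  obtain ⟨y, hyΔ, hky, hyc⟩ : ∃ y, Δ ≤ y ∧ k ≤ y ∧ y.choose r ≤ 2 * k.choose r := by
    rcases le_total Δ k with h | h
    · exact ⟨k, h, le_rfl, by omega⟩
    · exact ⟨Δ, le_rfl, h, hΔ⟩
  obtain ⟨M, rfl⟩ : ∃ M, N = M + 1 := ⟨N - 1, by omega⟩
  rw [Nat.add_sub_cancel] at *
  have hjy : j < y := by omega
  -- The 8 is the 4 of the rate condition times the 2 in the bound on `Δ.choose r`; its square is
  -- the 64 in `hest`.
  have hmain : 8 * k.choose r * y ≤ M.choose r * (y - j) := by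
    have h1 : 8 * k ^ r * y ≤ M ^ r * (y - j) := by
      refine (Nat.pow_le_pow_iff_left two_ne_zero).1 ?_
      refine Nat.le_of_mul_le_mul_right (c := 3 ^ r * 2 ^ r) ?_ (by positivity)
      calc (8 * k ^ r * y) ^ 2 * (3 ^ r * 2 ^ r)
          = (64 * 3 ^ r * (k ^ r) ^ 2) * (2 ^ r * y ^ 2) := by ring
        _ ≤ (2 ^ r * (M ^ r) ^ 2) * (3 ^ r * (y - j) ^ 2) := Nat.mul_le_mul hest (hy y hky)
        _ = (M ^ r * (y - j)) ^ 2 * (3 ^ r * 2 ^ r) := by ring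
    have h2 := choose_mul_pow_le r (show k ≤ M by omega)
    have hM : 0 < M ^ r := pow_pos (by omega) r
    refine Nat.le_of_mul_le_mul_right ?_ hM
    calc 8 * k.choose r * y * M ^ r = 8 * y * (k.choose r * M ^ r) := by ring
      _ ≤ 8 * y * (k ^ r * M.choose r) := Nat.mul_le_mul_left _ h2
      _ = M.choose r * (8 * k ^ r * y) := by ring
      _ ≤ M.choose r * (M ^ r * (y - j)) := Nat.mul_le_mul_left _ h1
      _ = M.choose r * (y - j) * M ^ r := by ring
  have hcross : 4 * y.choose (r + 1) * M ≤ M.choose (r + 1) * (y - j) := by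
    rcases Nat.lt_or_ge y r with hyr | hyr
    · rw [Nat.choose_eq_zero_of_lt (by omega : y < r + 1)]; simp
    have hypos := Nat.choose_pos hyr
    have hyM : y ≤ M := by
      by_contra hlt
      have h1 := Nat.choose_le_choose r (show M ≤ y by omega)
      have h2 : M.choose r * (y - j) ≤ M.choose r * y := Nat.mul_le_mul_left _ (Nat.sub_le _ _)
      have h3 : 8 * k.choose r ≤ M.choose r :=
        Nat.le_of_mul_le_mul_right (hmain.trans h2) (by omega)
      omega
    have e1 := Nat.choose_succ_right_eq y r
    have e2 := Nat.choose_succ_right_eq M r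
    have h1 : (y - r) * M ≤ y * (M - r) := by
      rw [Nat.sub_mul, Nat.mul_sub]
      have : y * r ≤ r * M := by rw [mul_comm]; exact Nat.mul_le_mul_left r hyM
      omega
    refine Nat.le_of_mul_le_mul_right (c := r + 1) ?_ (Nat.succ_pos r)
    calc 4 * y.choose (r + 1) * M * (r + 1) = 4 * y.choose r * ((y - r) * M) := by
          rw [mul_right_comm, mul_assoc 4, e1]; ring
      _ ≤ 4 * y.choose r * (y * (M - r)) := Nat.mul_le_mul_left _ h1
      _ ≤ 4 * (2 * k.choose r) * (y * (M - r)) :=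
          Nat.mul_le_mul_right _ (Nat.mul_le_mul_left _ hyc)
      _ = (8 * k.choose r * y) * (M - r) := by ring
      _ ≤ (M.choose r * (y - j)) * (M - r) := Nat.mul_le_mul_right _ hmain
      _ = M.choose (r + 1) * (y - j) * (r + 1) := by
          rw [mul_right_comm, mul_right_comm _ (y - j), e2]
  have hyj : (0 : ℝ) < (y : ℝ) - j := by
    have : (j : ℝ) < y := by exact_mod_cast hjy
    linarith
  have hM0 : (0 : ℝ) < M := by exact_mod_cast (by omega : 0 < M)
  have hjM : (0 : ℝ) ≤ (M : ℝ) - j := by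
    have : (j : ℝ) ≤ M := by exact_mod_cast (by omega : j ≤ M)
    linarith
  have hmono : (j.choose (r + 1) : ℝ) ≤ (y.choose (r + 1) : ℝ) := by
    exact_mod_cast Nat.choose_le_choose _ hjy.le
  -- `ρ` is the slope of the chord of the shifted binomial over `[0, y - j]`, which dominates by
  -- convexity.
  refine ⟨((y.choose (r + 1) : ℝ) - (j.choose (r + 1) : ℝ)) / ((y : ℝ) - j),
    div_nonneg (by linarith) hyj.le, ?_, fun d hd => ?_⟩
  · have hc : 4 * (y.choose (r + 1) : ℝ) * M ≤ (M.choose (r + 1) : ℝ) * ((y : ℝ) - j) := by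
      rw [← Nat.cast_sub hjy.le]; exact_mod_cast hcross
    have h1 := choose_sub_mul_le r hr (show j ≤ M by omega)
    push_cast
    rw [show (M : ℝ) + 1 - 1 - j = M - j by ring]
    refine le_of_mul_le_mul_right ?_ hM0
    refine le_trans ?_ h1
    rw [mul_div_assoc', div_mul_eq_mul_div, div_mul_eq_mul_div, div_le_iff₀ hyj]
    have h2 := mul_le_mul_of_nonneg_left hc hjM
    have h3 : (0 : ℝ) ≤ (j.choose (r + 1) : ℝ) * (M - j) * M := by positivity
    linarith
  · have := (thirdConvex_chooseFn r j hr).chord (show d ≤ y - j by omega)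
    simp only [chooseFn, zero_add, Nat.sub_add_cancel hjy.le, Nat.cast_sub hjy.le] at this
    rw [div_mul_eq_mul_div, le_div_iff₀ hyj]
    linarith

/-- The rate bound for triples of edges, where triangles count. -/
lemma exists_rate_three {j Δ : ℕ} (hkN : k + 1 ≤ N) (hN : 64 ≤ N) (hjk : 4 * j ≤ k)
    (hk1 : 1 ≤ k) (hest : 12 * k ^ 2 ≤ (N - 1) ^ 2)
    (hΔ : (Δ.choose 2 : ℝ) ≤ 2 * (k.choose 2 : ℝ) + k) :
    ∃ ρ : ℝ, 0 ≤ ρ ∧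
      4 * ρ * ((N : ℝ) - 1 - j) ≤ ((N - 1).choose 3 : ℝ) - (j.choose 3 : ℝ) ∧
      ∀ d : ℕ, d + j ≤ Δ → ((d + j).choose 3 : ℝ) - (j.choose 3 : ℝ)
        + d * (d - 1 : ℝ) / 6 ≤ ρ * d := by
  have hkR : (1 : ℝ) ≤ k := by exact_mod_cast hk1
  obtain ⟨u, huΔ, hku, huc⟩ : ∃ u : ℕ, Δ ≤ u ∧ k ≤ u ∧ (u : ℝ) * (u - 1) ≤ 2 * k ^ 2 := by
    rcases le_total Δ k with h | h
    · exact ⟨k, h, le_rfl, by nlinarith⟩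
    · refine ⟨Δ, le_rfl, h, ?_⟩
      rw [Nat.cast_choose_two, Nat.cast_choose_two] at hΔ
      linarith
  obtain ⟨M, rfl⟩ : ∃ M, N = M + 1 := ⟨N - 1, by omega⟩
  rw [Nat.add_sub_cancel] at *
  have hM : (63 : ℝ) ≤ M := by exact_mod_cast (by omega : 63 ≤ M)
  have hu1 : (1 : ℝ) ≤ u := by exact_mod_cast (by omega : 1 ≤ u)
  have hju : 4 * (j : ℝ) ≤ u := by exact_mod_cast (by omega : 4 * j ≤ u)
  have hj0 : (0 : ℝ) ≤ j := Nat.cast_nonneg j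
  have hjM : (0 : ℝ) ≤ (M : ℝ) - j := by
    have : (j : ℝ) ≤ M := by exact_mod_cast (by omega : j ≤ M)
    linarith
  have hest' : 12 * (k : ℝ) ^ 2 ≤ M ^ 2 := by exact_mod_cast hest
  -- `2/9 = (1/6)(4/3)`: the left side of the bound is `d/6` times the quadratic in `key`, and `4/3`
  -- exceeds `1 + 1/4 + 1/16`, its leading size at `d = u - j`, `j = u/4`.
  refine ⟨2 / 9 * (u * (u - 1)), mul_nonneg (by norm_num) (mul_nonneg (by linarith) (by linarith)),
    ?_, fun d hd => ?_⟩
  · have h1 := choose_sub_mul_le 2 (by norm_num) (show j ≤ M by omega)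
    push_cast
    rw [show (M : ℝ) + 1 - 1 - j = M - j by ring]
    have hM0 : (0 : ℝ) < M := by linarith
    refine le_of_mul_le_mul_right ?_ hM0
    refine le_trans ?_ h1
    rw [cast_choose_three]
    have h2 : 4 * (2 / 9 * ((u : ℝ) * (u - 1))) ≤ ((M : ℝ) - 1) * (M - 2) / 6 := by nlinarith
    have h3 := mul_le_mul_of_nonneg_left h2 (mul_nonneg hjM hM0.le)
    linarith
  · rcases Nat.eq_zero_or_pos d with rfl | hd0
    · simp
    have hd1 : (1 : ℝ) ≤ d := by exact_mod_cast hd0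
    have hdu : (d : ℝ) + j ≤ u := by exact_mod_cast (by omega : d + j ≤ u)
    rw [cast_choose_three, cast_choose_three]
    push_cast
    have key : ((d : ℝ) - 1) ^ 2 + 3 * j * (d - 1) + 3 * j * (j - 1) ≤ 4 / 3 * (u * (u - 1)) := by
      have hx : (d : ℝ) - 1 ≤ u - j - 1 := by linarith
      have q1 : ((d : ℝ) - 1) ^ 2 ≤ (u - j - 1) ^ 2 := pow_le_pow_left₀ (by linarith) hx 2
      have q2 : 3 * (j : ℝ) * (d - 1) ≤ 3 * j * (u - j - 1) :=
        mul_le_mul_of_nonneg_left hx (by linarith)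
      have q3 : (0 : ℝ) ≤ (u - 4 * j) * (u + j) := mul_nonneg (by linarith) (by linarith)
      nlinarith
    have := mul_le_mul_of_nonneg_left key (show (0 : ℝ) ≤ d / 6 by linarith)
    linarith

end Rates

/-! ### The choice of the threshold -/

/-- The threshold for the degrees of a cover. -/
lemma exists_threshold {N ℓ : ℕ} (hℓ : 1 ≤ ℓ) (hN : 4 * ℓ + 1 ≤ N) :
    ∃ k : ℕ, 8 * ℓ * N + 8 ≤ 3 * (k + 1) ^ 2 + 4 * (k + 1) + 4 * ℓ ^ 2 + 4 * ℓ ∧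
      3 * k ^ 2 + 4 * k + 4 * ℓ ^ 2 + 4 * ℓ < 8 * ℓ * N + 8 ∧ k + 2 ≤ N ∧ ℓ ≤ k + 1 := by
  classical
  obtain ⟨M, rfl⟩ : ∃ M, N = M + 2 := ⟨N - 2, by omega⟩
  have hex : 8 * ℓ * (M + 2) + 8 ≤ 3 * (M + 1) ^ 2 + 4 * (M + 1) + 4 * ℓ ^ 2 + 4 * ℓ := by
    obtain ⟨c, rfl⟩ : ∃ c, M = 4 * ℓ + c - 1 := ⟨M + 1 - 4 * ℓ, by omega⟩
    obtain ⟨b, rfl⟩ : ∃ b, ℓ = b + 1 := ⟨ℓ - 1, by omega⟩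
    rw [show 4 * (b + 1) + c - 1 = 4 * b + 3 + c by omega]
    nlinarith [Nat.zero_le (b * c), Nat.zero_le (c * c), Nat.zero_le (b * b)]
  -- `K = k + 1` is the least admissible value, so `k` fails the inequality; that failure bounds `k`
  -- from above.
  let p : ℕ → Prop := fun K => 8 * ℓ * (M + 2) + 8 ≤ 3 * K ^ 2 + 4 * K + 4 * ℓ ^ 2 + 4 * ℓ
  have hp : ∃ K, p K := ⟨M + 1, hex⟩
  have hspec : p (Nat.find hp) := Nat.find_spec hp
  have hle : Nat.find hp ≤ M + 1 := Nat.find_min' hp hex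
  have hlow : ℓ ≤ Nat.find hp := by
    by_contra hlt
    have h1 : Nat.find hp ≤ ℓ := by omega
    have h2 : 8 * ℓ * (M + 2) + 8 ≤ 3 * Nat.find hp ^ 2 + 4 * Nat.find hp + 4 * ℓ ^ 2 + 4 * ℓ := hspec
    have h3 := Nat.pow_le_pow_left h1 2
    nlinarith
  obtain ⟨k, hk⟩ : ∃ k, Nat.find hp = k + 1 := ⟨Nat.find hp - 1, by omega⟩
  have hmin : ¬ p k := Nat.find_min hp (by omega)
  rw [hk] at hspec hle hlow
  exact ⟨k, hspec, not_le.1 hmin, by omega, hlow⟩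

lemma threshold_bounds {M ℓ k : ℕ} (hℓ : 2 ≤ ℓ) (hN : 4 * ℓ + 1 ≤ M + 1)
    (hk1 : 8 * ℓ * (M + 1) + 8 ≤ 3 * (k + 1) ^ 2 + 4 * (k + 1) + 4 * ℓ ^ 2 + 4 * ℓ)
    (hk2 : 3 * k ^ 2 + 4 * k + 4 * ℓ ^ 2 + 4 * ℓ < 8 * ℓ * (M + 1) + 8) :
    3 * ℓ ≤ k + 2 ∧ 3 * k ^ 2 * (M + 1) ≤ 8 * ℓ * M ^ 2 := by
  have hk3 : 3 * ℓ ≤ k + 2 := by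
    by_contra hlt
    have h1 : ℓ * (4 * ℓ + 1) ≤ ℓ * (M + 1) := Nat.mul_le_mul_left _ hN
    have h5 : (k + 1 + 2) ^ 2 ≤ (3 * ℓ) ^ 2 := Nat.pow_le_pow_left (by omega) 2
    nlinarith
  refine ⟨hk3, ?_⟩
  have h0 : 2 * ℓ ≤ ℓ ^ 2 := by rw [pow_two]; exact Nat.mul_le_mul_right _ hℓ
  have h1 : 3 * k ^ 2 + 16 * ℓ ≤ 8 * ℓ * (M + 1) := by
    rcases Nat.eq_or_lt_of_le hℓ with rfl | hℓ3
    · linarith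
    · have h3 : 3 * ℓ ≤ ℓ ^ 2 := by rw [pow_two]; exact Nat.mul_le_mul_right _ hℓ3
      linarith
  have h2 := Nat.mul_le_mul_right (M + 1) h1
  linarith

/-- `K²` is about `8ℓN/3`, at least `(64/3) c ℓ²`, which exceeds `(cℓ)²` for `c ≤ 16`. -/
lemma le_threshold {M ℓ k c : ℕ} (hc : 4 ≤ c) (hN : 8 * c * ℓ ≤ M + 1)
    (hcc : c ≤ 16)
    (hk1 : 8 * ℓ * (M + 1) + 8 ≤ 3 * (k + 1) ^ 2 + 4 * (k + 1) + 4 * ℓ ^ 2 + 4 * ℓ) :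
    c * ℓ ≤ k := by
  by_contra hlt
  have h1 : ℓ * (8 * c * ℓ) ≤ ℓ * (M + 1) := Nat.mul_le_mul_left _ hN
  have h2 : (k + 1) ^ 2 ≤ (c * ℓ) ^ 2 := Nat.pow_le_pow_left (by omega) 2
  have h3 : ℓ ≤ ℓ ^ 2 := Nat.le_self_pow two_ne_zero ℓ
  have h4 : 4 * ℓ ^ 2 ≤ c * ℓ ^ 2 := Nat.mul_le_mul_right _ hc
  have h5 : c * (c * ℓ ^ 2) ≤ 16 * (c * ℓ ^ 2) := Nat.mul_le_mul_right _ hcc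
  have h6 : c * ℓ ≤ c * ℓ ^ 2 := Nat.mul_le_mul_left _ h3
  have h7 : k + 1 ≤ c * ℓ := by omega
  have h8 : (c * ℓ) ^ 2 = c * (c * ℓ ^ 2) := by ring
  have h9 : ℓ * (8 * c * ℓ) = 8 * (c * ℓ ^ 2) := by ring
  rw [h8] at h2
  rw [h9] at h1
  have h10 : 8 * ℓ * (M + 1) = 8 * (ℓ * (M + 1)) := by ring
  rw [h10] at hk1
  omega

/-- Triangles count only for `r = 2`. Otherwise `(2/3)^(r/2) ≤ (y - j)/y` is needed: for `r ≥ 3` the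
bound `y ≥ 3j` suffices, while `r = 1` needs the stronger `y ≥ 6j`. -/
lemma exists_rate_of_pow {r M ℓ k j Δ : ℕ} (hr : 1 ≤ r) (hN : 4 * ℓ + 1 ≤ M + 1)
    (hpow : 64 * 4 ^ r * ℓ ^ r ≤ (M + 1) ^ r)
    (hk1 : 8 * ℓ * (M + 1) + 8 ≤ 3 * (k + 1) ^ 2 + 4 * (k + 1) + 4 * ℓ ^ 2 + 4 * ℓ)
    (hk2 : 3 * k ^ 2 + 4 * k + 4 * ℓ ^ 2 + 4 * ℓ < 8 * ℓ * (M + 1) + 8) (hkM : k + 1 ≤ M)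
    (hj : j + 2 ≤ ℓ)
    (hΔ : (Δ.choose r : ℝ) ≤ 2 * (k.choose r : ℝ) + triCoeff (r + 1) * (k : ℝ)) :
    ∃ ρ : ℝ, 0 ≤ ρ ∧
      4 * ρ * (((M + 1 : ℕ) : ℝ) - 1 - j) ≤ (M.choose (r + 1) : ℝ) - (j.choose (r + 1) : ℝ) ∧
      ∀ d : ℕ, d + j ≤ Δ → ((d + j).choose (r + 1) : ℝ) - (j.choose (r + 1) : ℝ)
        + triCoeff (r + 1) * (d * (d - 1 : ℝ)) / 6 ≤ ρ * d := by
  obtain ⟨hk3, hest⟩ := threshold_bounds (by omega) hN hk1 hk2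
  by_cases hr2 : r = 2
  · subst hr2
    have hN32 : 32 * ℓ ≤ M + 1 := by
      refine (Nat.pow_le_pow_iff_left two_ne_zero).1 ?_
      rw [mul_pow]
      norm_num at hpow ⊢
      exact hpow
    have hk4 : 4 * ℓ ≤ k := le_threshold (c := 4) le_rfl hN32 (by norm_num) hk1
    have hest2 : 12 * k ^ 2 ≤ M ^ 2 := by
      refine Nat.le_of_mul_le_mul_right (c := 8 * ℓ) ?_ (by omega)
      have h1 := Nat.mul_le_mul_left (3 * k ^ 2) hN32
      linarith
    obtain ⟨ρ, h0, h1, h2⟩ := exists_rate_three (N := M + 1) (k := k) (j := j) (Δ := Δ) (by omega)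
      (by omega) (by omega) (by omega) hest2 (by simpa [triCoeff] using hΔ)
    exact ⟨ρ, h0, h1, fun d hd => by simpa [triCoeff] using h2 d hd⟩
  · have hθ : triCoeff (r + 1) = 0 := by
      unfold triCoeff; rw [if_neg]; omega
    rw [hθ, zero_mul, add_zero] at hΔ
    have hy : ∀ y, k ≤ y → 2 ^ r * y ^ 2 ≤ 3 ^ r * (y - j) ^ 2 := by
      intro y hy
      rcases Nat.eq_or_lt_of_le hr with rfl | hr'
      · have hN256 : 256 * ℓ ≤ M + 1 := by simpa using hpow
        have hk6 : 6 * ℓ ≤ k :=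
          le_threshold (c := 6) (by norm_num) (by omega) (by norm_num) hk1
        obtain ⟨e, rfl⟩ : ∃ e, y = 6 * j + e := ⟨y - 6 * j, by omega⟩
        rw [show 6 * j + e - j = 5 * j + e by omega]
        nlinarith [Nat.zero_le (j * e), Nat.zero_le (j * j), Nat.zero_le (e * e)]
      · obtain ⟨q, rfl⟩ : ∃ q, r = q + 2 := ⟨r - 2, by omega⟩
        have h3 : 2 * y ≤ 3 * (y - j) := by omega
        have h4 := Nat.pow_le_pow_left h3 2
        have h5 : 2 ^ q ≤ 3 ^ q := Nat.pow_le_pow_left (by norm_num) q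
        calc 2 ^ (q + 2) * y ^ 2 = 2 ^ q * (2 * y) ^ 2 := by ring
          _ ≤ 3 ^ q * (3 * (y - j)) ^ 2 := Nat.mul_le_mul h5 h4
          _ = 3 ^ (q + 2) * (y - j) ^ 2 := by ring
    obtain ⟨ρ, h0, h1, h2⟩ := exists_rate (N := M + 1) (k := k) (j := j) (Δ := Δ) hr (by omega)
      (by omega) (pow_estimate (by omega) hpow hest) hy (by exact_mod_cast hΔ)
    exact ⟨ρ, h0, h1, fun d hd => by rw [hθ]; simpa using h2 d hd⟩

/-- The lexicographic weight is maximal in the range of the main theorem. -/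
theorem wt_le_lexWt_of_pow {V : Type*} [DecidableEq V] [Finite V] {r N ℓ a s : ℕ} (hr : 1 ≤ r)
    (hℓ : 1 ≤ ℓ) (hpow : 64 * 4 ^ r * ℓ ^ r ≤ N ^ r) {G : SimpleGraph V} {S : Finset V}
    (hS : S.card = N) (has : a + s + 1 ≤ N) (haℓ : a + 1 ≤ ℓ)
    (hD : degSum G S + a * (a + 1) = 2 * a * N + 2 * s) :
    wt (chooseFn (r + 1) 0) (triCoeff (r + 1)) G S
      ≤ lexWt (chooseFn (r + 1) 0) (triCoeff (r + 1)) N a s := by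
  have hN : 4 * ℓ + 1 ≤ N := by
    refine lt_of_pow_lt_pow_left₀ r (Nat.zero_le N) ?_
    rw [mul_pow]
    have : 0 < 4 ^ r * ℓ ^ r := by positivity
    linarith
  obtain ⟨k, hk1, hk2, hkN, hℓk⟩ := exists_threshold hℓ hN
  obtain ⟨M, rfl⟩ : ∃ M, N = M + 1 := ⟨N - 1, by omega⟩
  have := wt_le_lexWt (V := V) (N := M + 1) (ℓ := ℓ) (K := k + 1) hr hk1 hkN (by omega) hℓk
    (fun j Δ hj hΔ => exists_rate_of_pow hr hN hpow hk1 hk2 (by omega) hj hΔ) a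
    (G := G) (S := S) (j := 0) (s := s) hS (by rwa [hS]) haℓ (by rwa [hS])
  rwa [hS] at this

/-! ### Intersecting edge sets as stars and triangles -/

section Counting

variable {n : ℕ}

lemma dg_univ (G : SimpleGraph (Fin n)) [DecidableRel G.Adj] (v : Fin n) :
    dg G univ v = G.degree v := by
  unfold dg
  rw [← SimpleGraph.card_neighborFinset_eq_degree, SimpleGraph.neighborFinset_eq_filter]
  congr

lemma numEdges_eq (G : SimpleGraph (Fin n)) [Fintype G.edgeSet] :
    numEdges G = G.edgeFinset.card := by
  unfold numEdges
  congr
  exact Subsingleton.elim _ _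

lemma degSum_univ (G : SimpleGraph (Fin n)) : degSum G univ = 2 * numEdges G := by
  classical
  rw [numEdges_eq, ← G.sum_degrees_eq_twice_card_edges]
  exact Finset.sum_congr rfl fun v _ => dg_univ G v

lemma interCount_eq (G : SimpleGraph (Fin n)) [Fintype G.edgeSet]
    [DecidablePred (fun H : Finset (Sym2 (Fin n)) => IntersectingEdges H)] (t : ℕ) :
    interCount G t = ((G.edgeFinset.powersetCard t).filter (fun H => IntersectingEdges H)).card := by
  unfold interCount
  congr
  exact Subsingleton.elim _ _

/-- The edges of a triangle. -/
def triEdges (p : Fin n × Fin n × Fin n) : Finset (Sym2 (Fin n)) :=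
  {s(p.1, p.2.1), s(p.2.1, p.2.2), s(p.2.2, p.1)}

lemma triEdges_card {x y z : Fin n} (hxy : x ≠ y) (hyz : y ≠ z) (hzx : z ≠ x) :
    (triEdges (x, y, z)).card = 3 := by
  unfold triEdges
  rw [Finset.card_eq_three]
  refine ⟨_, _, _, ?_, ?_, ?_, rfl⟩ <;> simp only [ne_eq, Sym2.eq_iff] <;> tauto

lemma mem_of_mem_triEdges {x y z p : Fin n} {e : Sym2 (Fin n)} (he : e ∈ triEdges (x, y, z))
    (hp : p ∈ e) : p = x ∨ p = y ∨ p = z := by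
  simp only [triEdges, Finset.mem_insert, Finset.mem_singleton] at he
  rcases he with rfl | rfl | rfl <;> simp only [Sym2.mem_iff] at hp <;> tauto

lemma triEdges_intersecting (x y z : Fin n) : IntersectingEdges (triEdges (x, y, z)) := by
  intro e he f hf
  simp only [triEdges, Finset.mem_insert, Finset.mem_singleton] at he hf
  rcases he with rfl | rfl | rfl <;> rcases hf with rfl | rfl | rfl <;>
    simp only [Sym2.mem_iff] <;> first
      | exact ⟨x, by tauto, by tauto⟩
      | exact ⟨y, by tauto, by tauto⟩
      | exact ⟨z, by tauto, by tauto⟩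

lemma triEdges_not_star {x y z : Fin n} (hxy : x ≠ y) (hyz : y ≠ z) (hzx : z ≠ x) :
    ¬ ∃ v, ∀ e ∈ triEdges (x, y, z), v ∈ e := by
  rintro ⟨v, hv⟩
  have h1 := hv s(x, y) (by simp [triEdges])
  have h2 := hv s(y, z) (by simp [triEdges])
  have h3 := hv s(z, x) (by simp [triEdges])
  simp only [Sym2.mem_iff] at h1 h2 h3
  rcases h1 with rfl | rfl <;> rcases h2 with h | h <;> rcases h3 with h' | h' <;>
    simp_all

/-- An intersecting set of edges without a common vertex is a triangle. -/
lemma exists_eq_triEdges {G : SimpleGraph (Fin n)} {H : Finset (Sym2 (Fin n))}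
    (hG : ∀ e ∈ H, e ∈ G.edgeSet) (hH : IntersectingEdges H) (hne : H.Nonempty)
    (hstar : ¬ ∃ v, ∀ e ∈ H, v ∈ e) :
    ∃ x y z, G.Adj x y ∧ G.Adj y z ∧ G.Adj z x ∧ H = triEdges (x, y, z) := by
  push Not at hstar
  obtain ⟨e, he⟩ := hne
  induction e using Sym2.ind with
  | _ x y =>
  obtain ⟨f, hf, hxf⟩ := hstar x
  obtain ⟨g, hg, hyg⟩ := hstar y
  have hxy : G.Adj x y := hG _ he
  have hyf : y ∈ f := by
    obtain ⟨v, hv, hvf⟩ := hH _ he f hf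
    rcases Sym2.mem_iff.1 hv with rfl | rfl
    · exact absurd hvf hxf
    · exact hvf
  have hxg : x ∈ g := by
    obtain ⟨v, hv, hvg⟩ := hH _ he g hg
    rcases Sym2.mem_iff.1 hv with rfl | rfl
    · exact hvg
    · exact absurd hvg hyg
  obtain ⟨z, rfl⟩ := hyf
  have hyz : G.Adj y z := hG _ hf
  have hzx : z ≠ x := fun e => hxf (by simp [e])
  have hzg : z ∈ g := by
    obtain ⟨v, hv, hvg⟩ := hH _ hf g hg
    rcases Sym2.mem_iff.1 hv with rfl | rfl
    · exact absurd hvg hyg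
    · exact hvg
  obtain rfl : g = s(z, x) := (Sym2.mem_and_mem_iff hzx).1 ⟨hzg, hxg⟩
  have hzx' : G.Adj z x := hG _ hg
  refine ⟨x, y, z, hxy, hyz, hzx', ?_⟩
  ext h
  simp only [triEdges, Finset.mem_insert, Finset.mem_singleton]
  constructor
  · intro hh
    have m1 : x ∈ h ∨ y ∈ h := by
      obtain ⟨v, hv, hvh⟩ := hH _ he h hh
      rcases Sym2.mem_iff.1 hv with rfl | rfl <;> tauto
    have m2 : y ∈ h ∨ z ∈ h := by
      obtain ⟨v, hv, hvh⟩ := hH _ hf h hh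
      rcases Sym2.mem_iff.1 hv with rfl | rfl <;> tauto
    have m3 : z ∈ h ∨ x ∈ h := by
      obtain ⟨v, hv, hvh⟩ := hH _ hg h hh
      rcases Sym2.mem_iff.1 hv with rfl | rfl <;> tauto
    have q1 := Sym2.mem_and_mem_iff (z := h) hxy.ne
    have q2 := Sym2.mem_and_mem_iff (z := h) hyz.ne
    have q3 := Sym2.mem_and_mem_iff (z := h) hzx
    tauto
  · rintro (rfl | rfl | rfl)
    · exact he
    · exact hf
    · exact hg

/-- The ordered triangles of a graph. -/
noncomputable def orderedTriangles (G : SimpleGraph (Fin n)) : Finset (Fin n × Fin n × Fin n) :=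
  open Classical in
  univ.filter (fun p => G.Adj p.1 p.2.1 ∧ G.Adj p.2.1 p.2.2 ∧ G.Adj p.2.2 p.1)

lemma mem_orderedTriangles {G : SimpleGraph (Fin n)} {x y z : Fin n} :
    (x, y, z) ∈ orderedTriangles G ↔ G.Adj x y ∧ G.Adj y z ∧ G.Adj z x := by
  simp [orderedTriangles]

lemma triW_eq_card (G : SimpleGraph (Fin n)) :
    triW (adjInd G) univ = (orderedTriangles G).card := by
  classical
  unfold triW orderedTriangles
  rw [Finset.card_filter, Nat.cast_sum, Fintype.sum_prod_type]
  refine Finset.sum_congr rfl fun x _ => ?_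
  rw [Fintype.sum_prod_type]
  refine Finset.sum_congr rfl fun y _ => Finset.sum_congr rfl fun z _ => ?_
  by_cases h1 : G.Adj x y <;> by_cases h2 : G.Adj y z <;> by_cases h3 : G.Adj z x <;>
    simp [adjInd, h1, h2, h3]

lemma card_fiber_triEdges {G : SimpleGraph (Fin n)} {x y z : Fin n} (hxy : G.Adj x y)
    (hyz : G.Adj y z) (hzx : G.Adj z x) :
    ((orderedTriangles G).filter (fun p => triEdges p = triEdges (x, y, z))).card = 6 := by
  classical
  have heq : (orderedTriangles G).filter (fun p => triEdges p = triEdges (x, y, z))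
      = {(x, y, z), (x, z, y), (y, x, z), (y, z, x), (z, x, y), (z, y, x)} := by
    ext ⟨p, q, r⟩
    simp only [Finset.mem_filter, mem_orderedTriangles, Finset.mem_insert, Finset.mem_singleton,
      Prod.mk.injEq]
    constructor
    · rintro ⟨⟨hpq, hqr, hrp⟩, h⟩
      have e1 : s(p, q) ∈ triEdges (x, y, z) := by rw [← h]; simp [triEdges]
      have e2 : s(q, r) ∈ triEdges (x, y, z) := by rw [← h]; simp [triEdges]
      have m1 := mem_of_mem_triEdges e1 (Sym2.mem_mk_left p q)
      have m2 := mem_of_mem_triEdges e1 (Sym2.mem_mk_right p q)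
      have m3 := mem_of_mem_triEdges e2 (Sym2.mem_mk_right q r)
      have n1 := hpq.ne
      have n2 := hqr.ne
      have n3 := hrp.ne
      rcases m1 with rfl | rfl | rfl <;> rcases m2 with rfl | rfl | rfl <;>
        rcases m3 with rfl | rfl | rfl <;> simp_all
    · have hs : ∀ a b : Fin n, s(a, b) = s(b, a) := fun a b => Sym2.eq_swap
      rintro (⟨rfl, rfl, rfl⟩ | ⟨rfl, rfl, rfl⟩ | ⟨rfl, rfl, rfl⟩ | ⟨rfl, rfl, rfl⟩ |
        ⟨rfl, rfl, rfl⟩ | ⟨rfl, rfl, rfl⟩)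
      · exact ⟨⟨hxy, hyz, hzx⟩, rfl⟩
      · refine ⟨⟨hzx.symm, hyz.symm, hxy.symm⟩, ?_⟩
        simp only [triEdges]; ext e; simp only [mem_insert, mem_singleton, hs p q, hs q r, hs r p]
        tauto
      · refine ⟨⟨hxy.symm, hzx.symm, hyz.symm⟩, ?_⟩
        simp only [triEdges]; ext e; simp only [mem_insert, mem_singleton, hs p q, hs q r, hs r p]
        tauto
      · refine ⟨⟨hyz, hzx, hxy⟩, ?_⟩
        simp only [triEdges]; ext e; simp only [mem_insert, mem_singleton]; tauto
      · refine ⟨⟨hzx, hxy, hyz⟩, ?_⟩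
        simp only [triEdges]; ext e; simp only [mem_insert, mem_singleton]; tauto
      · refine ⟨⟨hyz.symm, hxy.symm, hzx.symm⟩, ?_⟩
        simp only [triEdges]; ext e; simp only [mem_insert, mem_singleton, hs p q, hs q r, hs r p]
        tauto
  rw [heq]
  have n1 := hxy.ne
  have n2 := hyz.ne
  have n3 := hzx.ne
  have n1' := n1.symm
  have n2' := n2.symm
  have n3' := n3.symm
  simp [n1, n2, n3, n1', n2', n3']

/-- The number of intersecting subgraphs in terms of degrees and triangles. -/
lemma interCount_eq_wt (G : SimpleGraph (Fin n)) {t : ℕ} (ht : 2 ≤ t) :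
    (interCount G t : ℝ) = wt (chooseFn t 0) (triCoeff t) G univ := by
  classical
  rw [interCount_eq, ← Finset.card_filter_add_card_filter_not (fun H => ∃ v, ∀ e ∈ H, v ∈ e)]
  have hstar : (((G.edgeFinset.powersetCard t).filter (fun H => IntersectingEdges H)).filter
      (fun H => ∃ v, ∀ e ∈ H, v ∈ e)) = univ.biUnion
        (fun v => (G.edgeFinset.filter (fun e => v ∈ e)).powersetCard t) := by
    ext H
    simp only [Finset.mem_filter, Finset.mem_biUnion, Finset.mem_powersetCard, Finset.mem_univ,
      true_and, Finset.subset_iff]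
    constructor
    · rintro ⟨⟨⟨h1, h2⟩, -⟩, v, hv⟩
      exact ⟨v, fun e he => ⟨h1 he, hv e he⟩, h2⟩
    · rintro ⟨v, h1, h2⟩
      exact ⟨⟨⟨fun e he => (h1 he).1, h2⟩, fun e he f hf => ⟨v, (h1 he).2, (h1 hf).2⟩⟩,
        v, fun e he => (h1 he).2⟩
  have hcard1 : (univ.biUnion
      (fun v => (G.edgeFinset.filter (fun e => v ∈ e)).powersetCard t)).card
        = ∑ v, (dg G univ v).choose t := by
    rw [Finset.card_biUnion]
    · refine Finset.sum_congr rfl fun v _ => ?_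
      rw [Finset.card_powersetCard, dg_univ, ← SimpleGraph.card_incidenceFinset_eq_degree,
        SimpleGraph.incidenceFinset_eq_filter]
    -- As `t ≥ 2`, two distinct centres would force two distinct edges to coincide.
    · intro v _ w _ hvw
      rw [Function.onFun, Finset.disjoint_left]
      intro H hv hw
      simp only [Finset.mem_powersetCard, Finset.subset_iff, Finset.mem_filter] at hv hw
      obtain ⟨e, he, f, hf, hef⟩ := Finset.one_lt_card.1 (by omega : 1 < H.card)
      exact hef (((Sym2.mem_and_mem_iff hvw).1 ⟨(hv.1 he).2, (hw.1 he).2⟩).trans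
        ((Sym2.mem_and_mem_iff hvw).1 ⟨(hv.1 hf).2, (hw.1 hf).2⟩).symm)
  rw [hstar, hcard1]
  unfold wt
  push_cast
  congr 1
  set I := ((G.edgeFinset.powersetCard t).filter (fun H => IntersectingEdges H)).filter
      (fun H => ¬ ∃ v, ∀ e ∈ H, v ∈ e) with hI
  have hmem : ∀ H ∈ I, ∃ x y z, G.Adj x y ∧ G.Adj y z ∧ G.Adj z x ∧ H = triEdges (x, y, z) := by
    intro H hH
    simp only [hI, Finset.mem_filter, Finset.mem_powersetCard] at hH
    obtain ⟨⟨⟨h1, h2⟩, h3⟩, h4⟩ := hH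
    exact exists_eq_triEdges (fun e he => SimpleGraph.mem_edgeFinset.1 (h1 he)) h3
      (Finset.card_pos.1 (by omega)) h4
  unfold triCoeff
  split_ifs with h3
  · subst h3
    have hmaps : ∀ p ∈ orderedTriangles G, triEdges p ∈ I := by
      rintro ⟨x, y, z⟩ hp
      obtain ⟨hxy, hyz, hzx⟩ := mem_orderedTriangles.1 hp
      simp only [hI, Finset.mem_filter, Finset.mem_powersetCard]
      refine ⟨⟨⟨fun e he => ?_, triEdges_card hxy.ne hyz.ne hzx.ne⟩,
        triEdges_intersecting x y z⟩, triEdges_not_star hxy.ne hyz.ne hzx.ne⟩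
      rw [SimpleGraph.mem_edgeFinset]
      simp only [triEdges, Finset.mem_insert, Finset.mem_singleton] at he
      rcases he with rfl | rfl | rfl
      · exact hxy
      · exact hyz
      · exact hzx
    have hcard := Finset.card_eq_sum_card_fiberwise hmaps
    -- Six orderings of each triangle, matching the division by 6 in `wt`.
    have hfib : ∀ H ∈ I, ((orderedTriangles G).filter (fun p => triEdges p = H)).card = 6 := by
      intro H hH
      obtain ⟨x, y, z, hxy, hyz, hzx, rfl⟩ := hmem H hH
      exact card_fiber_triEdges hxy hyz hzx
    rw [Finset.sum_congr rfl hfib, Finset.sum_const, smul_eq_mul] at hcard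
    rw [triW_eq_card, hcard]
    push_cast
    ring
  · rw [zero_mul, zero_div, Nat.cast_eq_zero, Finset.card_eq_zero, Finset.eq_empty_iff_forall_notMem]
    intro H hH
    obtain ⟨x, y, z, hxy, hyz, hzx, rfl⟩ := hmem H hH
    simp only [hI, Finset.mem_filter, Finset.mem_powersetCard] at hH
    exact h3 (hH.1.1.2.symm.trans (triEdges_card hxy.ne hyz.ne hzx.ne))

end Counting

/-! ### The lexicographic graph and its parameters -/

section LexGraph

variable {n : ℕ}

/-- The graph in which the first `a` vertices are adjacent to all others, and the next vertex to
the `s` vertices following it. -/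
def quasiStar (n a s : ℕ) : SimpleGraph (Fin n) where
  Adj i j := (i < j ∧ (i.val < a ∨ i.val = a ∧ j.val ≤ a + s)) ∨
    (j < i ∧ (j.val < a ∨ j.val = a ∧ i.val ≤ a + s))
  symm := ⟨fun _ _ h => h.symm⟩
  loopless := ⟨fun _ h => by simp at h⟩

lemma quasiStar_adj_of_lt {a s : ℕ} {i j : Fin n} (h : i < j) :
    (quasiStar n a s).Adj i j ↔ i.val < a ∨ i.val = a ∧ j.val ≤ a + s := by
  have : ¬ j < i := h.asymm
  simp [quasiStar, h, this]

lemma quasiStar_tail_star {f : ℕ → ℝ} {θ : ℝ} {a s : ℕ} (h : a + s + 1 ≤ n) :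
    degSum (quasiStar n a s) (Finset.Ici ⟨a, by omega⟩) = 2 * s ∧
      wt f θ (quasiStar n a s) (Finset.Ici ⟨a, by omega⟩) = lexWt f θ (n - a) 0 s := by
  classical
  set G := quasiStar n a s with hG
  set v : Fin n := ⟨a, by omega⟩ with hv
  set S := Finset.Ici v with hS
  have hvS : v ∈ S := by simp [hS]
  have hlt : ∀ x ∈ S.erase v, v < x := fun x hx => by
    rw [Finset.mem_erase, hS, Finset.mem_Ici] at hx
    exact lt_of_le_of_ne hx.2 hx.1.symm
  have hnadj : ∀ x ∈ S.erase v, ∀ y ∈ S.erase v, ¬ G.Adj x y := by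
    intro x hx y hy hxy
    have h1 := Fin.lt_def.1 (hlt x hx)
    have h2 := Fin.lt_def.1 (hlt y hy)
    simp only [hv] at h1 h2
    rcases lt_trichotomy x y with h3 | h3 | h3
    · rw [hG, quasiStar_adj_of_lt h3] at hxy; omega
    · exact hxy.ne h3
    · have := hxy.symm
      rw [hG, quasiStar_adj_of_lt h3] at this; omega
  have hvadj : ∀ x ∈ S.erase v, (G.Adj v x ↔ x ∈ Finset.Ioc v ⟨a + s, by omega⟩) := by
    intro x hx
    rw [hG, quasiStar_adj_of_lt (hlt x hx), Finset.mem_Ioc]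
    have := hlt x hx
    simp only [hv, lt_self_iff_false, true_and, false_or, Fin.le_def, Fin.lt_def] at *
    tauto
  have hnb : S.filter (fun x => G.Adj v x) = Finset.Ioc v ⟨a + s, by omega⟩ := by
    ext x
    rw [Finset.mem_filter]
    constructor
    · rintro ⟨hx, hvx⟩
      exact (hvadj x (Finset.mem_erase.2 ⟨hvx.ne', hx⟩)).1 hvx
    · intro hx
      have hxl := (Finset.mem_Ioc.1 hx).1
      have hxS : x ∈ S := by rw [hS, Finset.mem_Ici]; exact hxl.le
      exact ⟨hxS, (hvadj x (Finset.mem_erase.2 ⟨hxl.ne', hxS⟩)).2 hx⟩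
  have hdv : dg G S v = s := by
    unfold dg
    have : (S.filter (fun x => G.Adj v x)).card = s := by
      rw [hnb, Fin.card_Ioc]
      simp [hv]
    convert this
  have hd0 : ∀ x ∈ S.erase v, dg G (S.erase v) x = 0 := fun x hx => by
    unfold dg
    rw [Finset.card_eq_zero, Finset.filter_eq_empty_iff]
    exact fun y hy => hnadj x hx y hy
  have hdx : ∀ x ∈ S.erase v, f (dg G S x) = f 0 + if G.Adj v x then f 1 - f 0 else 0 := by
    intro x hx
    split_ifs with hvx
    · rw [dg_erase_of_adj hvS hvx.symm, hd0 x hx]; ring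
    · rw [dg_erase_of_not_adj hvS (fun h' => hvx h'.symm), hd0 x hx]; ring
  have hcardS : S.card = n - a := by rw [hS, Fin.card_Ici]
  have hcard' := Finset.card_erase_add_one hvS
  have hfilter : (S.erase v).filter (fun x => G.Adj v x) = S.filter (fun x => G.Adj v x) := by
    ext x
    simp only [Finset.mem_filter, Finset.mem_erase]
    exact ⟨fun h => ⟨h.1.2, h.2⟩, fun h => ⟨⟨h.2.ne', h.1⟩, h.2⟩⟩
  have hsum : ∑ x ∈ S.erase v, f (dg G S x) = ((n : ℝ) - a - 1) * f 0 + s * (f 1 - f 0) := by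
    rw [Finset.sum_congr rfl hdx, Finset.sum_add_distrib, Finset.sum_const, ← Finset.sum_filter,
      Finset.sum_const, hfilter, hnb, Fin.card_Ioc, nsmul_eq_mul, nsmul_eq_mul]
    have : ((S.erase v).card : ℝ) = n - a - 1 := by
      have h1 : (S.erase v).card + 1 + a = n := by omega
      have : ((S.erase v).card : ℝ) + 1 + a = n := by exact_mod_cast h1
      linarith
    rw [this]
    simp [hv]
  constructor
  · rw [degSum_erase G hvS, hdv]
    unfold degSum
    rw [Finset.sum_eq_zero hd0, zero_add]
  · have hT : triW (adjInd G) S = 0 := by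
      rw [triW_erase (adjInd_self G) (adjInd_comm G) hvS]
      have e1 : triW (adjInd G) (S.erase v) = 0 :=
        Finset.sum_eq_zero fun x hx => Finset.sum_eq_zero fun y hy =>
          Finset.sum_eq_zero fun z _ => by rw [adjInd_of_not_adj (hnadj x hx y hy)]; ring
      rw [e1, Finset.sum_eq_zero fun x hx => Finset.sum_eq_zero fun y hy => by
        rw [adjInd_of_not_adj (hnadj x hx y hy)]; ring]
      ring
    unfold wt
    rw [hT, ← Finset.add_sum_erase _ _ hvS, hdv, hsum, lexWt_zero, Nat.cast_sub (by omega)]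
    ring

/-- The first vertex of each tail is full, so `wt_erase_full` on the graph side matches
`lexWt_succ`. `f` is quantified inside because each deletion shifts it. -/
lemma quasiStar_tail {θ : ℝ} {a s : ℕ} (h : a + s + 1 ≤ n) (b : ℕ) :
    ∀ {f : ℕ → ℝ} {c : ℕ} (hc : c + b = a),
      degSum (quasiStar n a s) (Finset.Ici ⟨c, by omega⟩) + b * (b + 1)
          = 2 * b * (n - c) + 2 * s ∧
        wt f θ (quasiStar n a s) (Finset.Ici ⟨c, by omega⟩) = lexWt f θ (n - c) b s := by
  induction b with
  | zero =>
    intro f c hc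
    obtain rfl : c = a := by omega
    have := quasiStar_tail_star (f := f) (θ := θ) h
    simpa using this
  | succ b ih =>
    intro f c hc
    obtain ⟨m, hm⟩ : ∃ m, n - c = m + 1 := ⟨n - c - 1, by omega⟩
    obtain ⟨ih1, ih2⟩ := ih (f := fun x => f (x + 1)) (c := c + 1) (by omega)
    rw [show n - (c + 1) = m by omega] at ih1 ih2
    set v : Fin n := ⟨c, by omega⟩ with hv
    set G := quasiStar n a s with hG
    have hvS : v ∈ Finset.Ici v := by simp
    have herase : (Finset.Ici v).erase v = Finset.Ici ⟨c + 1, by omega⟩ := by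
      ext x
      simp only [Finset.mem_erase, Finset.mem_Ici, Fin.le_def, Fin.ext_iff, hv, ne_eq]
      omega
    have hcard : (Finset.Ici v).card = m + 1 := by rw [Fin.card_Ici, ← hm]
    have hfull : dg G (Finset.Ici v) v + 1 = (Finset.Ici v).card := by
      classical
      rw [dg_erase_self hvS, ← Finset.card_erase_add_one hvS]
      unfold dg
      rw [Finset.filter_true_of_mem]
      intro x hx
      rw [herase, Finset.mem_Ici, Fin.le_def] at hx
      have hvx : v < x := by rw [Fin.lt_def]; simp only [hv]; simp only at hx; omega
      rw [hG, quasiStar_adj_of_lt hvx]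
      simp only [hv]
      omega
    have hdv : dg G (Finset.Ici v) v = m := by omega
    have hD := degSum_erase G hvS
    rw [herase, hdv] at hD
    constructor
    · rw [hm]
      nlinarith
    · rw [wt_erase_full hvS hfull, herase, hdv, ih2, hm, lexWt_succ (by omega)]
      have : (degSum G (Finset.Ici ⟨c + 1, by omega⟩) : ℝ) + b * (b + 1)
          = 2 * b * m + 2 * s := by exact_mod_cast ih1
      rw [← eq_sub_iff_add_eq] at this
      rw [this]; ring

lemma quasiStar_wt {f : ℕ → ℝ} {θ : ℝ} {a s : ℕ} (h : a + s + 1 ≤ n) :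
    degSum (quasiStar n a s) univ + a * (a + 1) = 2 * a * n + 2 * s ∧
      wt f θ (quasiStar n a s) univ = lexWt f θ n a s := by
  have huniv : Finset.Ici (⟨0, by omega⟩ : Fin n) = univ := by
    ext x; simp [Fin.le_def]
  have := quasiStar_tail (f := f) (θ := θ) h a (c := 0) (by omega)
  rwa [huniv, Nat.sub_zero] at this

lemma lexBefore_pair {i j k l : Fin n} (hij : i < j) (hkl : k < l) :
    LexBefore {i, j} {k, l} ↔ i < k ∨ (i = k ∧ j < l) := by
  unfold LexBefore
  simp only [Finset.mem_symmDiff, Finset.mem_insert, Finset.mem_singleton]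
  constructor
  · rintro ⟨x, hx, hmin, hxA⟩
    have h1 := hmin i
    have h2 := hmin k
    have h3 := hmin l
    grind
  · rintro (h | ⟨rfl, h⟩)
    · exact ⟨i, by grind, fun y hy => by grind, Or.inl rfl⟩
    · exact ⟨j, by grind, fun y hy => by grind, Or.inr rfl⟩

lemma mem_pairs {A : Finset (Fin n)} :
    A ∈ Finset.powersetCard 2 (univ : Finset (Fin n)) ↔ ∃ i j, i < j ∧ A = {i, j} := by
  rw [Finset.mem_powersetCard_univ, Finset.card_eq_two]
  constructor
  · rintro ⟨x, y, hxy, rfl⟩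
    rcases lt_or_gt_of_ne hxy with h | h
    · exact ⟨x, y, h, rfl⟩
    · exact ⟨y, x, h, Finset.pair_comm x y⟩
  · rintro ⟨i, j, hij, rfl⟩
    exact ⟨i, j, hij.ne, rfl⟩

lemma card_pairs_adj (G : SimpleGraph (Fin n)) (E : Finset (Finset (Fin n)))
    (hE : ∀ A, A ∈ E ↔ ∃ i j, i < j ∧ G.Adj i j ∧ A = {i, j}) : E.card = numEdges G := by
  classical
  rw [numEdges_eq]
  symm
  refine Finset.card_bij (fun e _ => e.toFinset) ?_ ?_ ?_
  · intro e he
    induction e using Sym2.ind with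
    | _ x y =>
    have hxy : G.Adj x y := SimpleGraph.mem_edgeFinset.1 he
    rw [hE, Sym2.toFinset_mk_eq]
    rcases lt_or_gt_of_ne hxy.ne with h | h
    · exact ⟨x, y, h, hxy, rfl⟩
    · exact ⟨y, x, h, hxy.symm, Finset.pair_comm x y⟩
  · intro e _ f _ hef
    refine Sym2.ext fun x => ?_
    rw [← Sym2.mem_toFinset, hef, Sym2.mem_toFinset]
  · intro A hA
    obtain ⟨i, j, hij, hadj, rfl⟩ := (hE A).1 hA
    exact ⟨s(i, j), SimpleGraph.mem_edgeFinset.2 hadj, Sym2.toFinset_mk_eq⟩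

/-- The edges of `quasiStar` form an initial segment of the lexicographic order, and an initial
segment is determined by its size. -/
lemma lexGraph_eq_quasiStar {a s m : ℕ} (hm : numEdges (quasiStar n a s) = m) :
    lexGraph n m = quasiStar n a s := by
  classical
  have key : ∀ i j : Fin n, i < j →
      (({i, j} : Finset (Fin n)) ∈ lexFamily n 2 m ↔ (quasiStar n a s).Adj i j) := by
    intro i j hij
    obtain ⟨E, hE⟩ : ∃ E : Finset (Finset (Fin n)), ∀ A, A ∈ E ↔
        ∃ i j, i < j ∧ (quasiStar n a s).Adj i j ∧ A = {i, j} :=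
      ⟨univ.filter fun A => ∃ i j, i < j ∧ (quasiStar n a s).Adj i j ∧ A = {i, j}, fun A => by
        simp⟩
    have hcard := card_pairs_adj _ E hE
    rw [hm] at hcard
    have hpair : ({i, j} : Finset (Fin n)) ∈ Finset.powersetCard 2 (univ : Finset (Fin n)) :=
      mem_pairs.2 ⟨i, j, hij, rfl⟩
    unfold lexFamily
    rw [Finset.mem_filter]
    simp only [hpair, true_and]
    rw [← hcard]
    constructor
    · intro hlt
      by_contra hn
      refine absurd hlt (not_lt.2 (Finset.card_le_card fun B hB => ?_))
      obtain ⟨k, l, hkl, hadj, rfl⟩ := (hE B).1 hB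
      rw [Finset.mem_filter]
      refine ⟨mem_pairs.2 ⟨k, l, hkl, rfl⟩, (lexBefore_pair hkl hij).2 ?_⟩
      rw [quasiStar_adj_of_lt hkl] at hadj
      rw [quasiStar_adj_of_lt hij] at hn
      simp only [Fin.lt_def, Fin.ext_iff] at *
      omega
    · intro hadj
      have hAE : ({i, j} : Finset (Fin n)) ∈ E := (hE _).2 ⟨i, j, hij, hadj, rfl⟩
      refine Finset.card_lt_card (Finset.ssubset_iff_of_subset (fun B hB => ?_) |>.2
        ⟨{i, j}, hAE, fun h => ?_⟩)
      · rw [Finset.mem_filter] at hB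
        obtain ⟨k, l, hkl, rfl⟩ := mem_pairs.1 hB.1
        have hb := (lexBefore_pair hkl hij).1 hB.2
        refine (hE _).2 ⟨k, l, hkl, ?_, rfl⟩
        rw [quasiStar_adj_of_lt hij] at hadj
        rw [quasiStar_adj_of_lt hkl]
        simp only [Fin.lt_def, Fin.ext_iff] at *
        omega
      · rw [Finset.mem_filter, lexBefore_pair hij hij] at h
        simp at h
  ext i j
  change (i ≠ j ∧ {i, j} ∈ lexFamily n 2 m) ↔ _
  rcases lt_trichotomy i j with h | h | h
  · rw [key i j h]
    exact and_iff_right h.ne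
  · subst h
    simp
  · rw [Finset.pair_comm, key j i h, SimpleGraph.adj_comm]
    exact and_iff_right h.ne'

/-- Requiring `1 ≤ s` excludes the description `(a + 1, 0)` of a completed row; `lt_of_params`
relies on this. -/
lemma exists_quasiStar_params (n : ℕ) : ∀ {m : ℕ}, 1 ≤ m → m ≤ n.choose 2 →
    ∃ a s, 1 ≤ s ∧ a + s + 1 ≤ n ∧ 2 * m + a * (a + 1) = 2 * a * n + 2 * s := by
  induction n with
  | zero => intro m h1 h2; simp at h2; omega
  | succ n ih =>
    intro m h1 h2
    rcases Nat.lt_or_ge n m with h | h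
    · have e : (n + 1).choose 2 = n + n.choose 2 := by
        rw [Nat.choose_succ_succ' n 1, Nat.choose_one_right]
      obtain ⟨k, rfl⟩ : ∃ k, m = n + k := ⟨m - n, by omega⟩
      obtain ⟨a, s, hs, has, hD⟩ := ih (m := k) (by omega) (by omega)
      exact ⟨a + 1, s, hs, by omega, by linarith⟩
    · exact ⟨0, m, h1, by omega, by ring⟩

lemma lexGraph_params {m : ℕ} (h1 : 1 ≤ m) (h2 : m ≤ n.choose 2) :
    ∃ a s, 1 ≤ s ∧ a + s + 1 ≤ n ∧ 2 * m + a * (a + 1) = 2 * a * n + 2 * s ∧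
      lexGraph n m = quasiStar n a s ∧ numEdges (lexGraph n m) = m := by
  obtain ⟨a, s, hs, has, hD⟩ := exists_quasiStar_params n h1 h2
  have hq := (quasiStar_wt (f := fun _ => 0) (θ := 0) has).1
  rw [degSum_univ] at hq
  have hm : numEdges (quasiStar n a s) = m := by omega
  have := lexGraph_eq_quasiStar hm
  exact ⟨a, s, hs, has, hD, this, by rw [this, hm]⟩

lemma lexGraph_zero : lexGraph n 0 = ⊥ := by
  ext i j
  simp [lexGraph, lexFamily]

lemma eq_bot_of_numEdges {G : SimpleGraph (Fin n)} (h : numEdges G = 0) : G = ⊥ := by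
  classical
  rw [numEdges_eq, Finset.card_eq_zero] at h
  exact SimpleGraph.edgeFinset_eq_empty.1 h

lemma numEdges_lexGraph {m : ℕ} (h : m ≤ n.choose 2) : numEdges (lexGraph n m) = m := by
  rcases Nat.eq_zero_or_pos m with rfl | hm
  · classical
    rw [lexGraph_zero, numEdges_eq, SimpleGraph.edgeFinset_bot, Finset.card_empty]
  · obtain ⟨a, s, -, -, -, -, h⟩ := lexGraph_params hm h
    exact h

lemma interCount_zero (G : SimpleGraph (Fin n)) : interCount G 0 = 1 := by
  classical
  rw [interCount_eq, Finset.powersetCard_zero, Finset.filter_true_of_mem, Finset.card_singleton]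
  intro H hH e he
  rw [Finset.mem_singleton.1 hH] at he
  simp at he

lemma interCount_one (G : SimpleGraph (Fin n)) : interCount G 1 = numEdges G := by
  classical
  rw [interCount_eq, Finset.filter_true_of_mem, Finset.card_powersetCard, Nat.choose_one_right,
    numEdges_eq]
  intro H hH e he f hf
  obtain ⟨g, rfl⟩ := Finset.card_eq_one.1 (Finset.mem_powersetCard.1 hH).2
  rw [Finset.mem_singleton] at he hf
  subst he hf
  induction f using Sym2.ind with
  | _ x y => exact ⟨x, by simp, by simp⟩

lemma pow_of_rpow_le {r ℓ : ℕ} (hr : 1 ≤ r)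
    (h : (2 : ℝ) ^ ((2 : ℝ) + 6 / (((r + 1 : ℕ) : ℝ) - 1)) * (ℓ : ℝ) ≤ (n : ℝ)) :
    64 * 4 ^ r * ℓ ^ r ≤ n ^ r := by
  have hr0 : (r : ℝ) ≠ 0 := by exact_mod_cast (by omega : r ≠ 0)
  have h1 := pow_le_pow_left₀ (by positivity) h r
  rw [mul_pow, ← Real.rpow_natCast ((2 : ℝ) ^ _) r, ← Real.rpow_mul (by norm_num)] at h1
  have e : ((2 : ℝ) + 6 / (((r + 1 : ℕ) : ℝ) - 1)) * r = ((6 + 2 * r : ℕ) : ℝ) := by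
    push_cast
    rw [add_sub_cancel_right]
    field_simp
    ring
  rw [e, Real.rpow_natCast, pow_add, pow_mul] at h1
  norm_num at h1
  exact_mod_cast h1

/-- If `a ≥ ℓ`, the first `ℓ` vertices already carry `C(n,2) - C(n-ℓ,2)` edges, and `s ≥ 1` gives
one more. -/
lemma lt_of_params {ℓ m a s : ℕ} (hs : 1 ≤ s) (has : a + s + 1 ≤ n)
    (hD : 2 * m + a * (a + 1) = 2 * a * n + 2 * s)
    (hm : m ≤ n.choose 2 - (n - ℓ).choose 2) : a + 1 ≤ ℓ := by
  by_contra hlt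
  obtain ⟨e, rfl⟩ : ∃ e, a = ℓ + e := ⟨a - ℓ, by omega⟩
  obtain ⟨c, rfl⟩ : ∃ c, n = ℓ + e + s + 1 + c := ⟨n - (ℓ + e + s + 1), by omega⟩
  have e1 : (ℓ + e + s + 1 + c).choose 2 * 2 = (ℓ + e + s + 1 + c) * (ℓ + e + s + c) := by
    have := Nat.choose_succ_right_eq (ℓ + e + s + 1 + c) 1
    rw [Nat.choose_one_right] at this
    rw [this]; congr 1; omega
  have e2 : (ℓ + e + s + 1 + c - ℓ).choose 2 * 2 = (e + s + 1 + c) * (e + s + c) := by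
    rw [show ℓ + e + s + 1 + c - ℓ = e + s + 1 + c by omega]
    have := Nat.choose_succ_right_eq (e + s + 1 + c) 1
    rw [Nat.choose_one_right] at this
    rw [this]; congr 1; omega
  have hle : (ℓ + e + s + 1 + c - ℓ).choose 2 ≤ (ℓ + e + s + 1 + c).choose 2 :=
    Nat.choose_le_choose 2 (by omega)
  have hm' : m * 2 + (ℓ + e + s + 1 + c - ℓ).choose 2 * 2 ≤ (ℓ + e + s + 1 + c).choose 2 * 2 := by
    omega
  rw [e1, e2] at hm'
  nlinarith [Nat.zero_le (e * s), Nat.zero_le (e * c), Nat.zero_le (e * e)]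

end LexGraph

/-! ### The extremal theorem -/

theorem proposition2p1 (t n ℓ : ℕ)
    (hn : t ≠ 1 → (2 : ℝ) ^ ((2 : ℝ) + 6 / ((t : ℝ) - 1)) * (ℓ : ℝ) ≤ (n : ℝ))
    (m : ℕ) (hm : m ≤ n.choose 2 - (n - ℓ).choose 2) :
    numEdges (lexGraph n m) = m ∧
      ∀ G : SimpleGraph (Fin n), numEdges G = m → interCount G t ≤ interCount (lexGraph n m) t := by
  have hm2 : m ≤ n.choose 2 := hm.trans (Nat.sub_le _ _)
  have hedges := numEdges_lexGraph hm2
  refine ⟨hedges, fun G hG => ?_⟩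
  -- For `t ≤ 1` the count depends only on the number of edges, and the weight formula, which needs
  -- unique star centres, is unavailable.
  rcases Nat.eq_zero_or_pos t with rfl | ht
  · rw [interCount_zero, interCount_zero]
  rcases Nat.eq_or_lt_of_le ht with rfl | ht2
  · rw [interCount_one, interCount_one, hG, hedges]
  rcases Nat.eq_zero_or_pos m with rfl | hm0
  · rw [eq_bot_of_numEdges hG, eq_bot_of_numEdges hedges]
  obtain ⟨r, rfl⟩ : ∃ r, t = r + 1 := ⟨t - 1, by omega⟩
  obtain ⟨a, s, hs, has, hD, hlex, -⟩ := lexGraph_params hm0 hm2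
  have haℓ := lt_of_params hs has hD hm
  have hpow := pow_of_rpow_le (r := r) (by omega) (hn (by omega))
  have hmain := wt_le_lexWt_of_pow (V := Fin n) (r := r) (by omega) (by omega) hpow (G := G)
    (S := univ) (Finset.card_fin n) has haℓ (by rw [degSum_univ, hG, hD])
  rw [← (quasiStar_wt has).2, ← hlex, ← interCount_eq_wt _ (by omega),
    ← interCount_eq_wt _ (by omega)] at hmain
  exact_mod_cast hmain
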